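/- **Spaces.** Fix a convenient category $\mathbf{Top}$ of topological spaces. Concretely: fix a family $(X_i)$ of locally compact test spaces (each point has a neighbourhood base of compact sets) such that all products $X_i\times X_j$ and the interval $I=[0,1]$ are $X$-generated, where a space $Y$ is $X$-generated if its topology is coinduced by all continuous maps $X_i\to Y$; $\mathbf{Top}$ is the category of $X$-generated spaces and continuous maps, and its products carry the $X$-generated refinement of the product topology. (With all compact Hausdorff spaces as test spaces, $\mathbf{Top}$ is the category of compactly generated spaces, which contains the compactly generated weakly Hausdorff ones.) **Left linear categories.** A $\mathbf{Top}_*$-category $\mathcal{C}$ is a category whose morphism sets $\mathcal{C}(A,B)$ are pointed spaces in $\mathbf{Top}$ with base point $0$, such that composition $\mathcal{C}(B,D)\times\mathcal{C}(A,B)\to\mathcal{C}(A,D)$, $(x,y)\mapsto xy$, is continuous and $x0=0$, $0y=0$. It is left linear if moreover each $\mathcal{C}(A,B)$ is a (not necessarily commutative) topological monoid $(\mathcal{C}(A,B),+)$ with neutral element $0$, and $(x+x')y=xy+x'y$. A morphism $F\colon\mathcal{S}\to\mathcal{T}$ of left linear $\mathbf{Top}_*$-categories is a functor such that all maps $F\colon\mathcal{S}(A,B)\to\mathcal{T}(FA,FB)$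 are continuous monoid homomorphisms. **Distributivity.** Let $0\le N\le\infty$. An $N$-distributor for a left linear $\mathbf{Top}_*$-category $\mathcal{C}$ consists of cubes $\varphi_a^{x_0,\dots,x_m}\colon I^m\to\mathcal{C}(Z,B)$ for all finite $m$ with $0\le m\le N$, all objects $Z,A,B$, all $a\in\mathcal{C}(A,B)$ and $x_0,\dots,x_m\in\mathcal{C}(Z,A)$, such that $\varphi_a^{x}=ax$; for each $1\le m\le N$ and $1\le j\le m$, $$\varphi_a^{x_0,\dots,x_m}(t_1,\dots,t_m)=\begin{cases}\varphi_a^{x_0,\dots,x_{j-1}+x_j,\dots,x_m}(t_1,\dots,\widehat{t_j},\dots,t_m)&\text{if }t_j=0,\\ \varphi_a^{x_0,\dots,x_{j-1}}(t_1,\dots,t_{j-1})+\varphi_a^{x_j,\dots,x_m}(t_{j+1},\dots,t_m)&\text{if }t_j=1;\end{cases}$$ and the map $\mathcal{C}(A,B)\times\mathcal{C}(Z,A)^{m+1}\to\mathcal{C}(Z,B)^{I^m}$, $(a,x_0,\dots,x_m)\mapsto\varphi_a^{x_0,\dots,x_m}$, is continuous for all $m\le N$ and all $Z,A,B$. The category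 $\mathcal{C}$ is $N$-distributive if it admits an $N$-distributor. **Proposition.** Let $F\colon\mathcal{S}\to\mathcal{T}$ be a morphism of left linear $\mathbf{Top}_*$-categories such that for all objects $A,B$ of $\mathcal{S}$ the map $F\colon\mathcal{S}(A,B)\to\mathcal{T}(FA,FB)$ is a weak equivalence, i.e. it induces a bijection on path components and on all homotopy groups at all base points. Assume that every mapping space $\mathcal{S}(A,B)$ has the homotopy type of a CW complex. If $\mathcal{T}$ is $N$-distributive for some $N\ge1$ (or $N=\infty$), then $\mathcal{S}$ is $N$-distributive. -/

import Mathlib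

open CategoryTheory CategoryTheory.Limits Topology
open scoped unitInterval ContinuousMap

universe t w v u v₁ v₂ u₁ u₂

/-! ### Weak equivalences and CW homotopy type -/

/-- The map on `n`-dimensional loops (cubes collapsing the boundary) induced by a continuous map. -/
def genLoopMap {Y Z : Type*} [TopologicalSpace Y] [TopologicalSpace Z] (N : Type*) (f : C(Y, Z))
    (y : Y) (γ : GenLoop N Y y) : GenLoop N Z (f y) :=
  ⟨f.comp γ.1, fun t ht => congrArg f (γ.2 t ht)⟩

/-- The map `π_n(Y, y) → π_n(Z, f y)` induced by a continuous map `f : Y → Z`. -/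
def homotopyGroupMap {Y Z : Type*} [TopologicalSpace Y] [TopologicalSpace Z] (n : ℕ) (f : C(Y, Z))
    (y : Y) : HomotopyGroup.Pi n Y y → HomotopyGroup.Pi n Z (f y) :=
  Quotient.map (genLoopMap (Fin n) f y) fun _ _ h => ContinuousMap.HomotopicRel.comp_continuousMap h f

/-- The map on path components induced by a continuous map. -/
def zerothHomotopyMap {Y Z : Type*} [TopologicalSpace Y] [TopologicalSpace Z] (f : C(Y, Z)) :
    ZerothHomotopy Y → ZerothHomotopy Z :=
  Quotient.map f fun _ _ h => h.map f.continuous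

/-- A weak (homotopy) equivalence: a continuous map inducing a bijection on path components and on
all homotopy groups, at all base points. -/
structure IsWeakHomotopyEquiv {Y Z : Type*} [TopologicalSpace Y] [TopologicalSpace Z]
    (f : C(Y, Z)) : Prop where
  bijective_zeroth : Function.Bijective (zerothHomotopyMap f)
  bijective_pi : ∀ (n : ℕ), 1 ≤ n → ∀ y : Y, Function.Bijective (homotopyGroupMap n f y)

/-- A space has the homotopy type of a CW complex. -/
def HasCWHomotopyType (Y : Type v) [TopologicalSpace Y] : Prop :=
  ∃ K : TopCat.{v}, Nonempty (TopCat.CWComplex K) ∧ Nonempty (Y ≃ₕ K)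

/-! ### Convenient categories of spaces

A convenient category of spaces is given by a family `X` of test spaces; its objects are the
`X`-generated spaces. A map out of a product in this category, whose topology is the `X`-generated
refinement of the product topology, is continuous iff it is `ContinuousGeneratedBy X` on the
ordinary product. For the family of all compact Hausdorff spaces one gets the compactly generated
spaces. -/

/-- Conditions on a family of test spaces making the category of `X`-generated spaces cartesian
closed and making it contain the unit interval (hence all CW complexes). -/
class IsConvenient {ι : Type t} (X : ι → Type w) [∀ i, TopologicalSpace (X i)] : Prop where
  locallyCompactSpace : ∀ i, LocallyCompactSpace (X i)
  isGeneratedBy_prod : ∀ i j, IsGeneratedBy X (X i × X j)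
  isGeneratedBy_unitInterval : IsGeneratedBy X I

theorem locallyCompactSpace_of_compact_t2 (K : Type w) [TopologicalSpace K] [CompactSpace K]
    [T2Space K] : LocallyCompactSpace K :=
  inferInstance

/-- The family of all compact Hausdorff spaces (in a fixed universe) is convenient. -/
instance isConvenient_compHaus : IsConvenient (fun K : CompHaus.{w} => K) where
  locallyCompactSpace K := locallyCompactSpace_of_compact_t2 K
  isGeneratedBy_prod K L := by
    rw [isGeneratedBy_iff, continuous_def]
    intro U hU
    rw [WithGeneratedByTopology.isOpen_iff] at hU
    exact hU (i := CompHaus.of (K × L)) (ContinuousMap.id _)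
  isGeneratedBy_unitInterval := by
    rw [isGeneratedBy_iff, continuous_def]
    intro U hU
    rw [WithGeneratedByTopology.isOpen_iff] at hU
    have h := hU (i := CompHaus.of (ULift.{w} I)) ⟨ULift.down, continuous_uliftDown⟩
    exact h.preimage continuous_uliftUp

/-! ### Left linear pointed topological categories -/

/-- A category enriched in pointed spaces (in the convenient category of `X`-generated spaces):
composition `C(B, D) × C(A, B) → C(A, D)` is continuous, and the base points `0` satisfy
`x 0 = 0` and `0 y = 0` by `HasZeroMorphisms`. -/
class IsPointedTopCategory {ι : Type t} (X : ι → Type w)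
    [∀ i, TopologicalSpace (X i)] (C : Type u) [Category.{v} C] [HasZeroMorphisms C]
    [∀ A B : C, TopologicalSpace (A ⟶ B)] : Prop where
  isGeneratedBy_hom : ∀ A B : C, IsGeneratedBy X (A ⟶ B)
  continuous_comp : ∀ A B D : C,
    ContinuousGeneratedBy X (fun p : (B ⟶ D) × (A ⟶ B) => p.2 ≫ p.1)

/-- An addition on each morphism set, making it a (not necessarily commutative) monoid whose
neutral element is the base point `0`. -/
class HomAddition (C : Type u) [Category.{v} C] [HasZeroMorphisms C] where
  add : ∀ {A B : C}, (A ⟶ B) → (A ⟶ B) → (A ⟶ B)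
  add_assoc : ∀ {A B : C} (x y z : A ⟶ B), add (add x y) z = add x (add y z)
  zero_add : ∀ {A B : C} (x : A ⟶ B), add 0 x = x
  add_zero : ∀ {A B : C} (x : A ⟶ B), add x 0 = x

instance homAdd {C : Type u} [Category.{v} C] [HasZeroMorphisms C] [HomAddition C]
    (A B : C) : Add (A ⟶ B) :=
  ⟨HomAddition.add⟩

instance homAddMonoid {C : Type u} [Category.{v} C] [HasZeroMorphisms C] [HomAddition C]
    (A B : C) : AddMonoid (A ⟶ B) where
  add_assoc := HomAddition.add_assoc
  zero_add := HomAddition.zero_add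
  add_zero := HomAddition.add_zero
  nsmul := nsmulRec

/-- A left linear pointed topological category: the mapping spaces are topological monoids and
`(x + x') y = x y + x' y`. The composite `x y` is `y ≫ x`. -/
class IsLeftLinear {ι : Type t} (X : ι → Type w)
    [∀ i, TopologicalSpace (X i)] (C : Type u) [Category.{v} C] [HasZeroMorphisms C]
    [∀ A B : C, TopologicalSpace (A ⟶ B)] [HomAddition C] : Prop extends IsPointedTopCategory X C where
  continuous_add : ∀ A B : C,
    ContinuousGeneratedBy X (fun p : (A ⟶ B) × (A ⟶ B) => p.1 + p.2)
  comp_add : ∀ {A B D : C} (y : A ⟶ B) (x x' : B ⟶ D), y ≫ (x + x') = y ≫ x + y ≫ x'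

/-- A morphism of left linear pointed topological categories: a functor which is continuous and a
monoid homomorphism on mapping spaces (in particular it preserves base points). -/
structure IsLeftLinearMorphism {S : Type u₁} [Category.{v₁} S]
    [HasZeroMorphisms S] [∀ A B : S, TopologicalSpace (A ⟶ B)] [HomAddition S] {T : Type u₂} [Category.{v₂} T]
    [HasZeroMorphisms T] [∀ A B : T, TopologicalSpace (A ⟶ B)] [HomAddition T] (F : S ⥤ T) : Prop where
  continuous_map : ∀ A B : S, Continuous (fun x : A ⟶ B => F.map x)
  map_zero : ∀ A B : S, F.map (0 : A ⟶ B) = 0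
  map_add : ∀ {A B : S} (x y : A ⟶ B), F.map (x + y) = F.map x + F.map y

/-- The continuous map `S(A, B) → T(FA, FB)` induced by a morphism `F`. -/
def IsLeftLinearMorphism.mapHom {S : Type u₁} [Category.{v₁} S]
    [HasZeroMorphisms S] [∀ A B : S, TopologicalSpace (A ⟶ B)] [HomAddition S] {T : Type u₂} [Category.{v₂} T]
    [HasZeroMorphisms T] [∀ A B : T, TopologicalSpace (A ⟶ B)] [HomAddition T] {F : S ⥤ T}
    (hF : IsLeftLinearMorphism F) (A B : S) : C(A ⟶ B, F.obj A ⟶ F.obj B) :=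
  ⟨fun x => F.map x, hF.continuous_map A B⟩

/-! ### Distributors -/

/-- An `N`-distributor (`N = ∞` allowed): cubes `cube m a x = φ_a^{x_0, …, x_m} : I^m → C(Z, B)`
for `m ≤ N`, where `a : A → B` and `x_0, …, x_m : Z → A`. The cubes with `m > N` are not subject to
any condition and carry no information. The coordinates `t_1, …, t_m` are indexed from `0` here. -/
structure Distributor {ι : Type t} (X : ι → Type w)
    [∀ i, TopologicalSpace (X i)] (C : Type u) [Category.{v} C] [HasZeroMorphisms C]
    [∀ A B : C, TopologicalSpace (A ⟶ B)] [HomAddition C] (N : ℕ∞) where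
  cube : ∀ (m : ℕ) {Z A B : C}, (A ⟶ B) → (Fin (m + 1) → (Z ⟶ A)) → C(Fin m → I, Z ⟶ B)
  /-- `φ_a^x = a x`. -/
  cube_zero : ∀ {Z A B : C} (a : A ⟶ B) (x : Fin 1 → (Z ⟶ A)) (t : Fin 0 → I),
    cube 0 a x t = x 0 ≫ a
  /-- On a face where one coordinate of `t` is `0`, that coordinate is dropped and the two entries
  of `x` adjacent to the corresponding plus sign are added. -/
  cube_face_zero : ∀ m : ℕ, ((m + 1 : ℕ) : ℕ∞) ≤ N → ∀ {Z A B : C} (a : A ⟶ B)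
    (x : Fin (m + 2) → (Z ⟶ A)) (t : Fin (m + 1) → I) (j : Fin (m + 1)), t j = 0 →
      cube (m + 1) a x t = cube m a (j.castSucc.contractNth (· + ·) x) (j.removeNth t)
  /-- On a face where a coordinate of `t`, preceded by `p` and followed by `q` coordinates, is `1`,
  the cube is the external sum of a `p`-cube and a `q`-cube. -/
  cube_face_one : ∀ p q : ℕ, ((p + q + 1 : ℕ) : ℕ∞) ≤ N → ∀ {Z A B : C} (a : A ⟶ B)
    (x : Fin (p + q + 1 + 1) → (Z ⟶ A)) (t : Fin (p + q + 1) → I), t ⟨p, by omega⟩ = 1 →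
      cube (p + q + 1) a x t =
        cube p a (fun i : Fin (p + 1) => x ⟨i, by omega⟩) (fun i : Fin p => t ⟨i, by omega⟩) +
        cube q a (fun i : Fin (q + 1) => x ⟨p + 1 + i, by omega⟩)
          (fun i : Fin q => t ⟨p + 1 + i, by omega⟩)
  /-- The map `C(A, B) × C(Z, A)^{m+1} → C(Z, B)^{I^m}` is continuous. (As the source carries the
  `X`-generated topology, it does not matter whether the compact-open topology on the target is
  replaced by its `X`-generated refinement.) -/
  continuous_cube : ∀ m : ℕ, (m : ℕ∞) ≤ N → ∀ Z A B : C,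
    ContinuousGeneratedBy X
      (fun p : (A ⟶ B) × (Fin (m + 1) → (Z ⟶ A)) => cube m p.1 p.2)

/-- A left linear pointed topological category is `N`-distributive if it has an `N`-distributor. -/
def IsDistributive {ι : Type t} (X : ι → Type w)
    [∀ i, TopologicalSpace (X i)] (C : Type u) [Category.{v} C] [HasZeroMorphisms C]
    [∀ A B : C, TopologicalSpace (A ⟶ B)] [HomAddition C] (N : ℕ∞) : Prop :=
  Nonempty (Distributor X C N)

/-! ### Gluing continuous maps along finite closed covers -/

/-! Each map `F : S(A, B) → T(FA, FB)` is replaced by its path fibration `p : E(A, B) → T(FA, FB)`: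
a point of `E(A, B)` is a morphism `x` of `S` with a path starting at `F x`, and `p` takes the end
of the path. Since `F` is additive, `E(A, B)` has a coordinatewise, strictly associative sum, and
both `p` and the projection to `S(A, B)` are additive. So it suffices to lift the cubes of `T`
through `p` to cubes satisfying the same face relations; forgetting the paths then leaves a
distributor of `S`.

The lifting is an induction on dimension, starting from constant paths at `F (a x)`. The face
relations prescribe an `(m + 1)`-cube on its boundary, consistently by associativity, and the
distributor of `T` prescribes its projection. The missing family of cubes is therefore a lift of a
map on `S(A, B) × S(Z, A)^(m+2)` along the relative power of `p`, which sends a cube in `E` to its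
boundary values together with its image under `p`.

Such lifts exist for two reasons. First, `p` is a trivial fibration, because the homotopy fibres of
a weak equivalence are weakly contractible (`IsWeakHomotopyEquiv.isTrivialFibration`), and relative
powers of trivial fibrations with respect to boundaries of cubes are trivial fibrations
(`IsTrivialFibration.relPow`). Second, spaces of CW homotopy type lift along trivial fibrations
(`IsTrivialFibration.exists_lift`); the exponential law extends this to finite products in the
convenient category (`LiftsAlongTrivialFibrations.prod`). -/

theorem exists_continuousMap_glue {Y Z κ : Type*} [TopologicalSpace Y] [TopologicalSpace Z]
    [Finite κ] (P : κ → Set Y) (hP : ∀ k, IsClosed (P k)) (hcov : ∀ y, ∃ k, y ∈ P k)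
    (f : ∀ k, P k → Z) (hf : ∀ k, Continuous (f k))
    (hagree : ∀ k l y (hk : y ∈ P k) (hl : y ∈ P l), f k ⟨y, hk⟩ = f l ⟨y, hl⟩) :
    ∃ g : C(Y, Z), ∀ k (y : P k), g y = f k y := by
  have hU : ⋃ k, P k = Set.univ := Set.eq_univ_of_forall fun y => Set.mem_iUnion.2 (hcov y)
  have hg : ∀ k (y : P k), Set.liftCover P f hagree hU y = f k y := fun k y => by
    rw [Set.liftCover_coe]
  refine ⟨⟨Set.liftCover P f hagree hU, ?_⟩, hg⟩
  refine (locallyFinite_of_finite P).continuous hU hP fun k => ?_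
  rw [continuousOn_iff_continuous_domRestrict]
  exact (hf k).congr fun y => (hg k y).symm

theorem exists_continuousMap_glue_two {Y Z : Type*} [TopologicalSpace Y] [TopologicalSpace Z]
    (P Q : Set Y) (hP : IsClosed P) (hQ : IsClosed Q) (hcov : ∀ y, y ∈ P ∨ y ∈ Q)
    (f : P → Z) (g : Q → Z) (hf : Continuous f) (hg : Continuous g)
    (hagree : ∀ y (hy : y ∈ P) (hy' : y ∈ Q), f ⟨y, hy⟩ = g ⟨y, hy'⟩) :
    ∃ h : C(Y, Z), (∀ y : P, h y = f y) ∧ ∀ y : Q, h y = g y := by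
  obtain ⟨h, hh⟩ := exists_continuousMap_glue (κ := Bool) (fun b => bif b then P else Q)
    (fun b => by cases b <;> assumption)
    (fun y => (hcov y).elim (fun hy => ⟨true, hy⟩) (fun hy => ⟨false, hy⟩))
    (fun b => match b with | true => f | false => g)
    (fun b => by cases b <;> assumption)
    (fun b c y hb hc => by
      cases b <;> cases c
      · rfl
      · exact (hagree y hc hb).symm
      · exact hagree y hb hc
      · rfl)
  exact ⟨h, hh true, hh false⟩

/-! ### Path lifting and relative powers -/

section RelPow

variable {D D' E B : Type*} [TopologicalSpace D] [TopologicalSpace D'] [TopologicalSpace E]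
  [TopologicalSpace B]

/-- A point of `E` together with a path in `B` starting at its image. -/
abbrev PathLiftProblem (p : C(E, B)) :=
  {q : E × C(I, B) // p q.1 = q.2 0}

/-- A Hurewicz fibration, in terms of a path lifting function. -/
def HasPathLifting (p : C(E, B)) : Prop :=
  ∃ Λ : C(PathLiftProblem p, C(I, E)),
    ∀ q, Λ q 0 = q.1.1 ∧ ∀ s, p (Λ q s) = q.1.2 s

/-- The space of path lifting problems is universal: a homotopy with a lift of its start is a map
from `W` into it. No condition on `W` is needed. -/
theorem HasPathLifting.exists_lift {p : C(E, B)} (hp : HasPathLifting p) {W : Type*}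
    [TopologicalSpace W] (g : C(W, E)) (h : C(W × I, B)) (h0 : ∀ w, p (g w) = h (w, 0)) :
    ∃ H : C(W × I, E), (∀ w, H (w, 0) = g w) ∧ ∀ z, p (H z) = h z := by
  obtain ⟨Λ, hΛ⟩ := hp
  let φ : C(W, PathLiftProblem p) :=
    ⟨fun w => ⟨(g w, h.curry w), h0 w⟩, by fun_prop⟩
  refine ⟨(Λ.comp φ).uncurry, fun w => (hΛ (φ w)).1, fun z => (hΛ (φ z.1)).2 z.2⟩

/-- The image of a fibration is a union of path components, so a lifting problem may be deformed to
an easier one before it is solved. -/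
theorem HasPathLifting.mem_range_of_joined {p : C(E, B)} (hp : HasPathLifting p) {x y : B}
    (hxy : Joined x y) (hy : y ∈ Set.range p) : x ∈ Set.range p := by
  obtain ⟨γ⟩ := hxy.symm
  obtain ⟨e, rfl⟩ := hy
  obtain ⟨H, -, hH⟩ := hp.exists_lift (ContinuousMap.const Unit e)
    ⟨fun z => γ z.2, by fun_prop⟩ (fun w => by simp)
  exact ⟨H ((), 1), by simp [hH]⟩

/-- Relative lifting problems for `p` with respect to the inclusion `A ⊆ D`. -/
abbrev RelLift (p : C(E, B)) (A : Set D) :=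
  {q : C(A, E) × C(D, B) // ∀ a, p (q.1 a) = q.2 a}

/-- The map from `C(D, E)` to the space of relative lifting problems. It is surjective iff `p` has
the right lifting property with respect to the inclusion `A ⊆ D`. -/
def relPow (p : C(E, B)) (A : Set D) : C(C(D, E), RelLift p A) :=
  ⟨fun f => ⟨(f.restrict A, p.comp f), fun _ => rfl⟩,
    ((ContinuousMap.continuous_restrict A).prodMk p.continuous_postcomp).subtype_mk _⟩

theorem relPow_surjective_iff {p : C(E, B)} {A : Set D} :
    Function.Surjective (relPow p A) ↔ ∀ (u : C(A, E)) (v : C(D, B)), (∀ a, p (u a) = v a) →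
      ∃ f : C(D, E), (∀ a : A, f a = u a) ∧ ∀ d, p (f d) = v d := by
  constructor
  · intro h u v huv
    obtain ⟨f, hf⟩ := h ⟨(u, v), huv⟩
    have h1 := congrArg (fun q => q.1.1) hf
    have h2 := congrArg (fun q => q.1.2) hf
    exact ⟨f, fun a => DFunLike.congr_fun h1 a, fun d => DFunLike.congr_fun h2 d⟩
  · rintro h ⟨⟨u, v⟩, huv⟩
    obtain ⟨f, hf, hf'⟩ := h u v huv
    exact ⟨f, Subtype.ext (Prod.ext (ContinuousMap.ext hf) (ContinuousMap.ext hf'))⟩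

theorem relPow_surjective_of_homeomorph {p : C(E, B)} {A : Set D} {A' : Set D'} (e : D ≃ₜ D')
    (he : ∀ d, d ∈ A ↔ e d ∈ A') (h : Function.Surjective (relPow p A)) :
    Function.Surjective (relPow p A') := by
  rw [relPow_surjective_iff] at h ⊢
  intro u v huv
  obtain ⟨f, hf, hf'⟩ := h (u.comp ⟨fun a => ⟨e a, (he a).1 a.2⟩, by fun_prop⟩)
    (v.comp e) (fun a => huv _)
  refine ⟨f.comp e.symm, fun a => ?_, fun d => ?_⟩
  · have := hf ⟨e.symm a, by simp [he]⟩
    simpa using this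
  · simpa using hf' (e.symm d)

/-- A pair `(D, A)` such that `D × I` flows onto itself from `A × I ∪ D × 0`: the path
`s ↦ c (z, s)` starts in this subset and passes through `z` at time `τ z`, and `τ` vanishes on the
subset. -/
def HasCollar (A : Set D) : Prop :=
  ∃ (c : C((D × I) × I, D × I)) (τ : C(D × I, I)),
    (∀ z, (c (z, 0)).1 ∈ A ∨ (c (z, 0)).2 = 0) ∧ (∀ z, c (z, τ z) = z) ∧
      ∀ z, z.1 ∈ A ∨ z.2 = 0 → τ z = 0

theorem HasCollar.of_homeomorph {A : Set D} {A' : Set D'} (e : D ≃ₜ D')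
    (he : ∀ d, d ∈ A ↔ e d ∈ A') (h : HasCollar A) : HasCollar A' := by
  obtain ⟨c, τ, h1, h2, h3⟩ := h
  refine ⟨⟨fun z => (e (c ((e.symm z.1.1, z.1.2), z.2)).1, (c ((e.symm z.1.1, z.1.2), z.2)).2),
    by fun_prop⟩, ⟨fun z => τ (e.symm z.1, z.2), by fun_prop⟩, fun z => ?_, fun z => ?_,
    fun z hz => ?_⟩
  · simpa [← he] using h1 (e.symm z.1, z.2)
  · simp [h2]
  · exact h3 _ (by simpa [he] using hz)

/-- A path of relative lifting problems with a solution at time `0` is a map on `D × I` with a lift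
over `A × I ∪ D × 0`. The paths of the collar start in this subset, so `p` lifts their images;
evaluation at time `τ z` gives the lift at `z`. As `τ` vanishes on the subset, the prescribed values
are kept. Everything is done with the lifting problem as a parameter, which yields a continuous
lifting function. -/
theorem HasPathLifting.relPow [LocallyCompactSpace D] {p : C(E, B)} (hp : HasPathLifting p)
    {A : Set D} (hA : IsClosed A) (hc : HasCollar A) : HasPathLifting (relPow p A) := by
  obtain ⟨c, τ, h1, h2, h3⟩ := hc
  have : LocallyCompactSpace A := hA.locallyCompactSpace
  have hW0 : ∀ (w : PathLiftProblem (_root_.relPow p A)) (a : A),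
      (w.1.2 0).1.1 a = w.1.1 a := fun w a => by
    rw [← w.2]; rfl
  have hW0' : ∀ (w : PathLiftProblem (_root_.relPow p A)) (d : D),
      (w.1.2 0).1.2 d = p (w.1.1 d) := fun w d => by
    rw [← w.2]; rfl
  obtain ⟨g, hg, hg'⟩ := exists_continuousMap_glue_two (Z := E)
    {z : {z : PathLiftProblem (_root_.relPow p A) × (D × I) // z.2.1 ∈ A ∨ z.2.2 = 0} |
      z.1.2.1 ∈ A}
    {z : {z : PathLiftProblem (_root_.relPow p A) × (D × I) // z.2.1 ∈ A ∨ z.2.2 = 0} |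
      z.1.2.2 = 0} (hA.preimage (by fun_prop))
    (isClosed_singleton.preimage (f := fun z : {z : PathLiftProblem (_root_.relPow p A) ×
      (D × I) // z.2.1 ∈ A ∨ z.2.2 = 0} => z.1.2.2) (by fun_prop)) (fun z => z.2)
    (fun z => (z.1.1.1.1.2 z.1.1.2.2).1.1 ⟨z.1.1.2.1, z.2⟩)
    (fun z => z.1.1.1.1.1 z.1.1.2.1) (by fun_prop) (by fun_prop)
    (by
      rintro ⟨⟨w, d, s⟩, hz⟩ hy hy'
      obtain rfl : s = 0 := hy'
      exact hW0 w ⟨d, hy⟩)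
  obtain ⟨H, hH, hH'⟩ := hp.exists_lift
    (W := PathLiftProblem (_root_.relPow p A) × (D × I))
    ⟨fun z => g ⟨(z.1, c (z.2, 0)), h1 z.2⟩, by fun_prop⟩
    ⟨fun z => (z.1.1.1.2 (c (z.1.2, z.2)).2).1.2 (c (z.1.2, z.2)).1, by fun_prop⟩
    (by
      rintro ⟨w, z⟩
      show p (g _) = _
      rcases h1 z with h | h
      · refine (congrArg p (hg ⟨_, h⟩)).trans ?_
        exact (w.1.2 (c (z, 0)).2).2 ⟨_, h⟩
      · refine (congrArg p (hg' ⟨_, h⟩)).trans ?_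
        exact ((congrArg (fun s => (w.1.2 s).1.2 (c (z, 0)).1) h).trans (hW0' w _)).symm)
  have hHg : ∀ (w : PathLiftProblem (_root_.relPow p A)) (z : D × I) (hz : z.1 ∈ A ∨ z.2 = 0),
      H ((w, z), τ z) = g ⟨(w, z), hz⟩ := by
    intro w z hz
    have h4 : c (z, 0) = z := by rw [← h3 z hz, h2]
    rw [h3 z hz, hH]
    show g _ = g _
    congr 3
  let G : C((PathLiftProblem (_root_.relPow p A) × I) × D, E) :=
    ⟨fun x => H ((x.1.1, (x.2, x.1.2)), τ (x.2, x.1.2)), by fun_prop⟩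
  refine ⟨G.curry.curry, fun w => ⟨?_, fun s => ?_⟩⟩
  · ext d
    exact (hHg w (d, 0) (Or.inr rfl)).trans (hg' ⟨_, rfl⟩)
  · refine Subtype.ext (Prod.ext (ContinuousMap.ext fun a => ?_) (ContinuousMap.ext fun d => ?_))
    · exact (hHg w (a, s) (Or.inl a.2)).trans (hg ⟨_, a.2⟩)
    · refine (hH' _).trans ?_
      show (w.1.2 (c ((d, s), _)).2).1.2 (c ((d, s), _)).1 = _
      rw [h2]

/-- The boundary of a product of pairs. -/
def prodBoundary (A' : Set D') (A : Set D) : Set (D' × D) :=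
  {z | z.1 ∈ A' ∨ z.2 ∈ A}

/-- The exponential law for pairs: a map into a space of maps on `D`, prescribed on `A'`, whose
restriction to `A` is also prescribed, is a map on `D' × D` prescribed on `A' × D ∪ D' × A`. -/
theorem relPow_relPow_surjective_iff [LocallyCompactSpace D] {p : C(E, B)}
    {A : Set D} (hA : IsClosed A) {A' : Set D'} (hA' : IsClosed A') :
    Function.Surjective (relPow (relPow p A) A') ↔
      Function.Surjective (relPow p (prodBoundary A' A)) := by
  have : LocallyCompactSpace A := hA.locallyCompactSpace
  rw [relPow_surjective_iff, relPow_surjective_iff]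
  constructor
  · intro h u v huv
    let u' : C(A', C(D, E)) := ContinuousMap.curry ⟨fun z => u ⟨(z.1, z.2), Or.inl z.1.2⟩,
      by fun_prop⟩
    let v₁ : C(D', C(A, E)) := ContinuousMap.curry ⟨fun z => u ⟨(z.1, z.2), Or.inr z.2.2⟩,
      by fun_prop⟩
    let v' : C(D', RelLift p A) := ⟨fun d => ⟨(v₁ d, v.curry d), fun a => huv _⟩, by fun_prop⟩
    obtain ⟨f, hf, hf'⟩ := h u' v' (fun a => Subtype.ext (Prod.ext (ContinuousMap.ext fun d => rfl)
      (ContinuousMap.ext fun d => huv ⟨(a, d), Or.inl a.2⟩)))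
    refine ⟨f.uncurry, ?_, fun z => ?_⟩
    · rintro ⟨⟨d', d⟩, hz | hz⟩
      · exact DFunLike.congr_fun (hf ⟨d', hz⟩) d
      · exact DFunLike.congr_fun (congrArg (fun q => q.1.1) (hf' d')) ⟨d, hz⟩
    · exact DFunLike.congr_fun (congrArg (fun q => q.1.2) (hf' z.1)) z.2
  · intro h u v huv
    have huv₁ : ∀ (a' : A') (a : A), u a' a = (v a').1.1 a := fun a' a =>
      DFunLike.congr_fun (congrArg (fun q => q.1.1) (huv a')) a
    have huv₂ : ∀ (a' : A') (d : D), p (u a' d) = (v a').1.2 d := fun a' d =>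
      DFunLike.congr_fun (congrArg (fun q => q.1.2) (huv a')) d
    obtain ⟨g, hg, hg'⟩ := exists_continuousMap_glue_two (Z := E)
      {z : prodBoundary A' A | z.1.1 ∈ A'} {z : prodBoundary A' A | z.1.2 ∈ A}
      (hA'.preimage (by fun_prop)) (hA.preimage (by fun_prop)) (fun z => z.2)
      (fun z => u ⟨z.1.1.1, z.2⟩ z.1.1.2) (fun z => (v z.1.1.1).1.1 ⟨z.1.1.2, z.2⟩)
      (by fun_prop) (by fun_prop) (fun z hz hz' => huv₁ ⟨_, hz⟩ ⟨_, hz'⟩)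
    obtain ⟨f, hf, hf'⟩ := h g ⟨fun z => (v z.1).1.2 z.2, by fun_prop⟩ (by
      rintro ⟨z, hz | hz⟩
      · exact (congrArg p (hg ⟨_, hz⟩)).trans (huv₂ ⟨_, hz⟩ _)
      · exact (congrArg p (hg' ⟨_, hz⟩)).trans ((v z.1).2 ⟨_, hz⟩))
    refine ⟨f.curry, fun a => ContinuousMap.ext fun d => ?_, fun d' => Subtype.ext
      (Prod.ext (ContinuousMap.ext fun a => ?_) (ContinuousMap.ext fun d => ?_))⟩
    · exact (hf ⟨(a, d), Or.inl a.2⟩).trans (hg ⟨⟨(a, d), Or.inl a.2⟩, a.2⟩)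
    · exact (hf ⟨(d', a), Or.inr a.2⟩).trans (hg' ⟨⟨(d', a), Or.inr a.2⟩, a.2⟩)
    · exact hf' (d', d)

/-- The fibre of a continuous map. -/
abbrev Fibre (p : C(E, B)) (b : B) := {e : E // p e = b}

/-- Contracting `D` deforms the map to the base into a constant one, and a path in the base moves
the constant to `b₀`. Lifting this homotopy over `A` deforms the whole problem to an extension
problem in the fibre over `b₀`. Solvability is invariant under such deformations since the relative
power is a fibration. -/
theorem relPow_surjective_of_fibre [LocallyCompactSpace D] [ContractibleSpace D] {p : C(E, B)}
    (hp : HasPathLifting p) {A : Set D} (hA : IsClosed A) (hc : HasCollar A)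
    (h : ∀ b, ∃ b₀, Joined b b₀ ∧ ∀ u : C(A, Fibre p b₀), ∃ f : C(D, Fibre p b₀),
      ∀ a : A, f a = u a) :
    Function.Surjective (relPow p A) := by
  intro q
  obtain ⟨d₀, hd₀⟩ := id_nullhomotopic D
  obtain ⟨K⟩ := hd₀
  obtain ⟨b₀, ⟨β⟩, hb₀⟩ := h (q.1.2 d₀)
  let k₁ : Path q.1.2 (ContinuousMap.const D (q.1.2 d₀)) :=
    { toContinuousMap := ContinuousMap.curry ⟨fun z => q.1.2 (K z), by fun_prop⟩
      source' := by ext; simp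
      target' := by ext; simp }
  let k₂ : Path (ContinuousMap.const D (q.1.2 d₀)) (ContinuousMap.const D b₀) :=
    { toContinuousMap := ContinuousMap.curry ⟨fun z => β z.1, by fun_prop⟩
      source' := by ext; simp
      target' := by ext; simp }
  let k := k₁.trans k₂
  obtain ⟨H, hH, hH'⟩ := hp.exists_lift q.1.1 ⟨fun z => k z.2 z.1, by fun_prop⟩
    (fun a => by simpa using q.2 a)
  let P : C(I, RelLift p A) :=
    ⟨fun s => ⟨((H.comp .prodSwap).curry s, k s), fun a => hH' (a, s)⟩, by fun_prop⟩
  have hP0 : P 0 = q := Subtype.ext (Prod.ext (ContinuousMap.ext fun a => hH a) (k.source))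
  refine (hp.relPow hA hc).mem_range_of_joined (x := q) (y := P 1) ⟨⟨P, hP0, rfl⟩⟩ ?_
  obtain ⟨f, hf⟩ := hb₀ ⟨fun a => ⟨H (a, 1), by simp [hH']⟩, by fun_prop⟩
  refine ⟨⟨fun d => (f d).1, by fun_prop⟩, Subtype.ext (Prod.ext (ContinuousMap.ext fun a => ?_)
    (ContinuousMap.ext fun d => ?_))⟩
  · exact congrArg Subtype.val (hf a)
  · show p (f d).1 = k 1 d
    simp [(f d).2]

end RelPow

/-! ### Collars of balls and cubes -/

section Collar

variable {V : Type*} [NormedAddCommGroup V]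

/-- The scaling factor moving a point of `closedBall 0 1 × I`, seen from `(0, 2)`, to the boundary
part `sphere 0 1 × I ∪ closedBall 0 1 × {0}`. -/
noncomputable def collarFactor (z : Metric.closedBall (0 : V) 1 × I) : ℝ :=
  (max ‖(z.1 : V)‖ (1 - (z.2 : ℝ) / 2))⁻¹

theorem collarFactor_denom_pos (z : Metric.closedBall (0 : V) 1 × I) :
    0 < max ‖(z.1 : V)‖ (1 - (z.2 : ℝ) / 2) :=
  lt_max_of_lt_right (by linarith [z.2.2.2])

theorem continuous_collarFactor :
    Continuous (collarFactor : Metric.closedBall (0 : V) 1 × I → ℝ) := by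
  unfold collarFactor
  exact Continuous.inv₀ (by fun_prop) fun z => (collarFactor_denom_pos z).ne'

theorem one_le_collarFactor (z : Metric.closedBall (0 : V) 1 × I) : 1 ≤ collarFactor z :=
  (one_le_inv₀ (collarFactor_denom_pos z)).2
    (max_le (mem_closedBall_zero_iff.1 z.1.2) (by linarith [z.2.2.1]))

theorem collarFactor_le_two (z : Metric.closedBall (0 : V) 1 × I) : collarFactor z ≤ 2 := by
  unfold collarFactor
  rw [inv_le_comm₀ (collarFactor_denom_pos z) two_pos]
  exact le_max_of_le_right (by linarith [z.2.2.2])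

theorem collarFactor_mul_norm_le (z : Metric.closedBall (0 : V) 1 × I) :
    collarFactor z * ‖(z.1 : V)‖ ≤ 1 := by
  unfold collarFactor
  rw [inv_mul_le_one₀ (collarFactor_denom_pos z)]
  exact le_max_left _ _

theorem collarFactor_mul_le (z : Metric.closedBall (0 : V) 1 × I) :
    collarFactor z * (2 - (z.2 : ℝ)) ≤ 2 := by
  have : collarFactor z * (1 - (z.2 : ℝ) / 2) ≤ 1 := by
    unfold collarFactor
    rw [inv_mul_le_one₀ (collarFactor_denom_pos z)]
    exact le_max_right _ _
  linarith

theorem collarFactor_mul_eq (z : Metric.closedBall (0 : V) 1 × I) :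
    collarFactor z * ‖(z.1 : V)‖ = 1 ∨ collarFactor z * (2 - (z.2 : ℝ)) = 2 := by
  have h := (collarFactor_denom_pos z).ne'
  unfold collarFactor
  rcases max_choice ‖(z.1 : V)‖ (1 - (z.2 : ℝ) / 2) with h' | h' <;> rw [h'] at h ⊢
  · left; field_simp
  · right
    rw [inv_mul_eq_iff_eq_mul₀ h]
    ring

/-- The scaling factor at time `s` along the collar. -/
noncomputable def collarScale (x : (Metric.closedBall (0 : V) 1 × I) × I) : ℝ :=
  max 1 (collarFactor x.1 - x.2)

theorem continuous_collarScale :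
    Continuous (collarScale : (Metric.closedBall (0 : V) 1 × I) × I → ℝ) := by
  have := continuous_collarFactor (V := V)
  unfold collarScale
  fun_prop

theorem one_le_collarScale (x : (Metric.closedBall (0 : V) 1 × I) × I) : 1 ≤ collarScale x :=
  le_max_left _ _

theorem collarScale_le (x : (Metric.closedBall (0 : V) 1 × I) × I) :
    collarScale x ≤ collarFactor x.1 :=
  max_le (one_le_collarFactor _) (by linarith [x.2.2.1])

/-- Radial projection from the point `(0, 2)` outside the cylinder. The path slides along the ray
through `z`, from the boundary (scale `collarFactor z`) inwards to `z` (scale `1`), where it rests.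
It arrives at time `collarFactor z - 1`, which lies in `I` because the factor is between `1` and
`2`. -/
theorem hasCollar_sphere [NormedSpace ℝ V] :
    HasCollar {x : Metric.closedBall (0 : V) 1 | ‖(x : V)‖ = 1} := by
  have hscale : ∀ z : Metric.closedBall (0 : V) 1 × I, collarScale (z, 0) = collarFactor z :=
    fun z => by simp [collarScale, one_le_collarFactor]
  refine ⟨⟨fun x => (⟨collarScale x • (x.1.1 : V), ?_⟩,
    ⟨2 - collarScale x * (2 - (x.1.2 : ℝ)), ?_, ?_⟩), ?_⟩,
    ⟨fun z => ⟨collarFactor z - 1, ?_, ?_⟩, ?_⟩, fun z => ?_, fun z => ?_, fun z hz => ?_⟩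
  · rw [mem_closedBall_zero_iff, norm_smul, Real.norm_of_nonneg
      (zero_le_one.trans (one_le_collarScale x))]
    exact (mul_le_mul_of_nonneg_right (collarScale_le x) (norm_nonneg _)).trans
      (collarFactor_mul_norm_le _)
  · have := mul_le_mul_of_nonneg_right (collarScale_le x)
      (show 0 ≤ 2 - (x.1.2 : ℝ) by linarith [x.1.2.2.2])
    linarith [collarFactor_mul_le x.1]
  · have := mul_le_mul_of_nonneg_right (one_le_collarScale x)
      (show 0 ≤ 2 - (x.1.2 : ℝ) by linarith [x.1.2.2.2])
    linarith [x.1.2.2.2]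
  · have := continuous_collarScale (V := V)
    fun_prop
  · linarith [one_le_collarFactor z]
  · linarith [collarFactor_le_two z]
  · have := continuous_collarFactor (V := V)
    fun_prop
  · have h0 := zero_le_one.trans (one_le_collarFactor z)
    refine (collarFactor_mul_eq z).imp (fun h => ?_) (fun h => Subtype.ext ?_)
    · show ‖collarScale (z, 0) • (z.1 : V)‖ = 1
      rw [hscale, norm_smul, Real.norm_of_nonneg h0, h]
    · show 2 - collarScale (z, 0) * (2 - (z.2 : ℝ)) = 0
      rw [hscale, h, sub_self]
  · have h1 : ∀ h, collarScale (z, ⟨collarFactor z - 1, h⟩) = 1 := fun h => by simp [collarScale]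
    refine Prod.ext (Subtype.ext ?_) (Subtype.ext ?_)
    · exact (congrArg (· • (z.1 : V)) (h1 _)).trans (one_smul _ _)
    · exact (congrArg (fun κ => 2 - κ * (2 - (z.2 : ℝ))) (h1 _)).trans (by ring)
  · have h1 : collarFactor z = 1 := by
      refine le_antisymm ?_ (one_le_collarFactor z)
      rcases hz with hz | hz
      · have := collarFactor_mul_norm_le z
        rwa [show ‖(z.1 : V)‖ = 1 from hz, mul_one] at this
      · have := collarFactor_mul_le z
        rw [hz] at this
        simp only [Set.Icc.coe_zero, sub_zero] at this
        linarith
    exact Subtype.ext (by simp [h1])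

end Collar

/-- The cube is the unit ball of the sup norm. -/
noncomputable def cubeHomeomorph (n : ℕ) :
    (Fin n → I) ≃ₜ Metric.closedBall (0 : Fin n → ℝ) 1 where
  toFun x := ⟨fun i => 2 * (x i : ℝ) - 1, by
    rw [mem_closedBall_zero_iff, pi_norm_le_iff_of_nonneg zero_le_one]
    intro i
    rw [Real.norm_eq_abs, abs_le]
    constructor <;> linarith [(x i).2.1, (x i).2.2]⟩
  invFun y := fun i => ⟨(y.1 i + 1) / 2, by
    have h := (norm_le_pi_norm y.1 i).trans (mem_closedBall_zero_iff.1 y.2)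
    rw [Real.norm_eq_abs, abs_le] at h
    constructor <;> linarith [h.1, h.2]⟩
  left_inv x := by ext i; simp
  right_inv y := by ext i; simp; ring
  continuous_toFun := by fun_prop
  continuous_invFun := continuous_pi fun i => Continuous.subtype_mk
    ((((continuous_apply i).comp continuous_subtype_val).add continuous_const).div_const 2) _

theorem mem_boundary_iff_norm (n : ℕ) (x : Fin n → I) :
    x ∈ Cube.boundary (Fin n) ↔ ‖(cubeHomeomorph n x : Fin n → ℝ)‖ = 1 := by
  have h1 : ‖(cubeHomeomorph n x : Fin n → ℝ)‖ ≤ 1 :=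
    mem_closedBall_zero_iff.1 (cubeHomeomorph n x).2
  rw [← not_iff_not, ← ne_eq (a := ‖_‖), ← h1.lt_iff_ne, pi_norm_lt_iff one_pos]
  simp only [Cube.boundary, Set.mem_ofPred_eq, not_exists, not_or]
  refine forall_congr' fun i => ?_
  show _ ↔ ‖2 * (x i : ℝ) - 1‖ < 1
  rw [Real.norm_eq_abs, abs_lt]
  constructor
  · rintro ⟨h, h'⟩
    have := unitInterval.pos_iff_ne_zero.2 h
    have := unitInterval.lt_one_iff_ne_one.2 h'
    constructor <;> simp only [← Subtype.coe_lt_coe, Set.Icc.coe_zero, Set.Icc.coe_one] at * <;>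
      linarith
  · rintro ⟨h, h'⟩
    constructor <;> intro h'' <;> rw [h''] at h h' <;> norm_num at *

theorem hasCollar_cube (n : ℕ) : HasCollar (Cube.boundary (Fin n)) :=
  hasCollar_sphere.of_homeomorph (cubeHomeomorph n).symm fun d => by
    simp [mem_boundary_iff_norm]

theorem isClosed_cubeBoundary (n : ℕ) : IsClosed (Cube.boundary (Fin n)) := by
  have : Cube.boundary (Fin n) = ⋃ i : Fin n, {y | y i = 0} ∪ {y | y i = 1} := by
    ext y; simp [Cube.boundary]
  rw [this]
  exact isClosed_iUnion_of_finite fun i =>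
    (isClosed_eq (by fun_prop) (by fun_prop)).union (isClosed_eq (by fun_prop) (by fun_prop))

theorem mem_boundary_fin_one (s : I) :
    s ∈ ({0, 1} : Set I) ↔ (Homeomorph.funUnique (Fin 1) I).symm s ∈ Cube.boundary (Fin 1) := by
  simp [Cube.boundary]

theorem hasCollar_unitInterval : HasCollar ({0, 1} : Set I) :=
  (hasCollar_cube 1).of_homeomorph (Homeomorph.funUnique (Fin 1) I) fun d => by
    rw [mem_boundary_fin_one, Homeomorph.symm_apply_apply]

theorem isClosed_endpoints : IsClosed ({0, 1} : Set I) :=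
  (Set.toFinite _).isClosed

/-! ### Trivial fibrations -/

/-- Splitting a cube as a product of cubes. -/
def cubeProdHomeomorph (m n : ℕ) : (Fin m → I) × (Fin n → I) ≃ₜ (Fin (m + n) → I) where
  toEquiv := Fin.appendEquiv m n
  continuous_toFun := by
    refine continuous_pi fun i => ?_
    induction i using Fin.addCases with
    | left i => simpa [Fin.appendEquiv] using by fun_prop
    | right i => simpa [Fin.appendEquiv] using by fun_prop
  continuous_invFun := by
    simp only [Fin.appendEquiv]
    fun_prop

theorem mem_prodBoundary_iff (m n : ℕ) (z : (Fin m → I) × (Fin n → I)) :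
    z ∈ prodBoundary (Cube.boundary (Fin m)) (Cube.boundary (Fin n)) ↔
      cubeProdHomeomorph m n z ∈ Cube.boundary (Fin (m + n)) := by
  constructor
  · rintro (⟨i, hi⟩ | ⟨i, hi⟩)
    · exact ⟨Fin.castAdd n i, by simpa [cubeProdHomeomorph, Fin.appendEquiv] using hi⟩
    · exact ⟨Fin.natAdd m i, by simpa [cubeProdHomeomorph, Fin.appendEquiv] using hi⟩
  · rintro ⟨i, hi⟩
    induction i using Fin.addCases with
    | left i => exact Or.inl ⟨i, by simpa [cubeProdHomeomorph, Fin.appendEquiv] using hi⟩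
    | right i => exact Or.inr ⟨i, by simpa [cubeProdHomeomorph, Fin.appendEquiv] using hi⟩

section

variable {E B : Type*} [TopologicalSpace E] [TopologicalSpace B]

/-- A Hurewicz fibration which is a weak equivalence, expressed by the lifting property with respect
to the inclusions of the boundaries of cubes. -/
structure IsTrivialFibration (p : C(E, B)) : Prop where
  hasPathLifting : HasPathLifting p
  surjective_relPow : ∀ n, Function.Surjective (relPow p (Cube.boundary (Fin n)))

theorem relPow_relPow_cube_surjective_iff {p : C(E, B)} (m n : ℕ) :
    Function.Surjective (relPow (relPow p (Cube.boundary (Fin n))) (Cube.boundary (Fin m))) ↔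
      Function.Surjective (relPow p (Cube.boundary (Fin (m + n)))) := by
  rw [relPow_relPow_surjective_iff (isClosed_cubeBoundary n) (isClosed_cubeBoundary m)]
  exact ⟨relPow_surjective_of_homeomorph (cubeProdHomeomorph m n) (mem_prodBoundary_iff m n),
    relPow_surjective_of_homeomorph (cubeProdHomeomorph m n).symm fun d => by
      rw [mem_prodBoundary_iff, Homeomorph.apply_symm_apply]⟩

/-- By the exponential law, lifting against the boundary of the `m`-cube becomes lifting `p` against
the boundary of the `(m + n)`-cube. -/
theorem IsTrivialFibration.relPow {p : C(E, B)} (hp : IsTrivialFibration p) (n : ℕ) :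
    IsTrivialFibration (relPow p (Cube.boundary (Fin n))) where
  hasPathLifting := hp.hasPathLifting.relPow (isClosed_cubeBoundary n) (hasCollar_cube n)
  surjective_relPow m := (relPow_relPow_cube_surjective_iff m n).2 (hp.surjective_relPow (m + n))

theorem relPow_cube_succ_surjective {p : C(E, B)} (n : ℕ)
    (h : Function.Surjective (relPow (relPow p ({0, 1} : Set I)) (Cube.boundary (Fin n)))) :
    Function.Surjective (relPow p (Cube.boundary (Fin (n + 1)))) := by
  rw [relPow_relPow_surjective_iff isClosed_endpoints (isClosed_cubeBoundary n)] at h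
  refine relPow_surjective_of_homeomorph (((Homeomorph.refl _).prodCongr
    (Homeomorph.funUnique (Fin 1) I).symm).trans (cubeProdHomeomorph n 1)) (fun z => ?_) h
  rw [Homeomorph.trans_apply, ← mem_prodBoundary_iff]
  simp only [prodBoundary, Set.mem_ofPred_eq]
  exact or_congr Iff.rfl (mem_boundary_fin_one _)

end

/-! ### The path fibration of a map -/

section PathFibration

variable {Y Z : Type*} [TopologicalSpace Y] [TopologicalSpace Z]

/-- The total space of the path fibration of `f : Y → Z`: points `y` of `Y` with a path in `Z`
starting at `f y`. -/
abbrev PathFibration (f : C(Y, Z)) :=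
  {q : Y × C(I, Z) // q.2 0 = f q.1}

/-- The path fibration of `f`, sending `(y, γ)` to the end point of `γ`. -/
def pathFibrationEnd (f : C(Y, Z)) : C(PathFibration f, Z) :=
  ⟨fun q => q.1.2 1, by fun_prop⟩

theorem hasPathLifting_pathFibrationEnd (f : C(Y, Z)) : HasPathLifting (pathFibrationEnd f) := by
  -- The lift at time `s` appends to the given path the part of the base path over `[0, s]`. The
  -- result has length `1 + s` and is run at that speed, so that `s = 0` gives back the given path
  -- exactly.
  let φ : (PathLiftProblem (pathFibrationEnd f) × I) × I → Z := fun x =>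
    if (1 + (x.1.2 : ℝ)) * x.2 ≤ 1
      then x.1.1.1.1.1.2 (Set.projIcc 0 1 zero_le_one ((1 + (x.1.2 : ℝ)) * x.2))
      else x.1.1.1.2 (Set.projIcc 0 1 zero_le_one ((1 + (x.1.2 : ℝ)) * x.2 - 1))
  have hφ : Continuous φ := by
    refine Continuous.if_le ?_ ?_ (by fun_prop) continuous_const fun x hx => ?_
    · exact Continuous.eval (by fun_prop) (continuous_projIcc.comp (by fun_prop))
    · exact Continuous.eval (by fun_prop) (continuous_projIcc.comp (by fun_prop))
    · rw [hx, sub_self, Set.projIcc_right, Set.projIcc_left]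
      exact x.1.1.2
  let Φ : C(PathLiftProblem (pathFibrationEnd f) × I, C(I, Z)) := ContinuousMap.curry ⟨φ, hφ⟩
  have hΦ0 : ∀ x, Φ x 0 = x.1.1.1.1.2 0 := fun x => by
    show φ (x, 0) = _
    simp [φ]
  let Ψ : C(PathLiftProblem (pathFibrationEnd f) × I, PathFibration f) :=
    ⟨fun x => ⟨(x.1.1.1.1.1, Φ x), (hΦ0 x).trans x.1.1.1.2⟩, by fun_prop⟩
  refine ⟨Ψ.curry, fun q => ⟨Subtype.ext (Prod.ext rfl (ContinuousMap.ext fun r => ?_)),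
    fun s => ?_⟩⟩
  · show φ ((q, 0), r) = _
    simp [φ, r.2.2]
  · show φ ((q, s), 1) = _
    by_cases hs : s = 0
    · subst hs
      have h := q.2
      simp only [pathFibrationEnd, ContinuousMap.coe_mk] at h
      simpa [φ] using h
    · have : ¬ (s : ℝ) ≤ 0 := fun h => hs (Subtype.ext (le_antisymm h s.2.1))
      simp [φ, this]

/-- The base point of the homotopy fibre of `f` over `f y`. -/
def homotopyFibreBase (f : C(Y, Z)) (y : Y) : Fibre (pathFibrationEnd f) (f y) :=
  ⟨⟨(y, ContinuousMap.const I (f y)), rfl⟩, rfl⟩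

/-- Injectivity on `π₀` and surjectivity on `π₁` at `y` make the homotopy fibre path connected: they
provide a path `K` from `y₁` to `y` whose image is homotopic to `γ`, and `(y₁, f ∘ K)` shrinks along
`K` to the base point. -/
theorem joined_homotopyFibreBase (f : C(Y, Z)) (y : Y)
    (h0 : ∀ y₁, Joined (f y₁) (f y) → Joined y₁ y)
    (h1 : ∀ l : Path (f y) (f y), ∃ d : Path y y, (d.map f.continuous).Homotopic l)
    (e : Fibre (pathFibrationEnd f) (f y)) : Joined e (homotopyFibreBase f y) := by
  obtain ⟨⟨⟨y₁, γ⟩, hγ⟩, hγ'⟩ := e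
  let g : Path (f y₁) (f y) := ⟨γ, hγ, hγ'⟩
  obtain ⟨δ⟩ := h0 y₁ ⟨g⟩
  -- The loop `d` corrects the error between `f ∘ δ` and `g`.
  obtain ⟨d, hd⟩ := h1 ((δ.map f.continuous).symm.trans g)
  let K := δ.trans d
  have hK : (K.map f.continuous).Homotopic g := by
    rw [Path.map_trans]
    refine ((Path.Homotopic.refl _).hcomp hd).trans ?_
    refine (Path.Homotopic.symm ⟨Path.Homotopy.transAssoc _ _ _⟩).trans ?_
    refine (Path.Homotopic.hcomp (Path.Homotopic.symm ⟨Path.Homotopy.reflTransSymm _⟩)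
      (Path.Homotopic.refl g)).trans ⟨Path.Homotopy.reflTrans g⟩
  obtain ⟨G⟩ := hK.symm
  have j₁ : Joined (⟨⟨(y₁, γ), hγ⟩, hγ'⟩ : Fibre (pathFibrationEnd f) (f y))
      ⟨⟨(y₁, (K.map f.continuous).toContinuousMap), (K.map f.continuous).source⟩,
        (K.map f.continuous).target⟩ := by
    let c : C(I, C(I, Z)) := G.toHomotopy.toContinuousMap.curry
    refine ⟨⟨⟨fun s => ⟨⟨(y₁, c s), G.source s⟩, G.target s⟩,
      ((continuous_const.prodMk c.continuous).subtype_mk _).subtype_mk _⟩, ?_, ?_⟩⟩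
    · refine Subtype.ext (Subtype.ext (Prod.ext rfl (ContinuousMap.ext fun r => ?_)))
      exact G.apply_zero r
    · refine Subtype.ext (Subtype.ext (Prod.ext rfl (ContinuousMap.ext fun r => ?_)))
      exact G.apply_one r
  refine j₁.trans ?_
  -- At time `s` only the part of `f ∘ K` after `s` remains.
  let c : C(I, C(I, Z)) := ContinuousMap.curry ⟨fun z => f (K (max z.1 z.2)), by fun_prop⟩
  have hc0 : ∀ s, c s 0 = f (K s) := fun s => by simp [c]
  have hc1 : ∀ s, c s 1 = f y := fun s => by
    have : max s 1 = 1 := max_eq_right s.2.2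
    simp [c, this]
  refine ⟨⟨⟨fun s => ⟨⟨(K s, c s), hc0 s⟩, hc1 s⟩,
    ((K.continuous.prodMk c.continuous).subtype_mk _).subtype_mk _⟩, ?_, ?_⟩⟩
  · refine Subtype.ext (Subtype.ext (Prod.ext K.source (ContinuousMap.ext fun r => ?_)))
    simp [c]
  · refine Subtype.ext (Subtype.ext (Prod.ext K.target (ContinuousMap.ext fun r => ?_)))
    have : max 1 r = 1 := max_eq_left r.2.2
    simp [c, this, homotopyFibreBase]

end PathFibration

/-! ### Extending maps from the boundary of a cube -/

instance contractibleSpace_cube (n : ℕ) : ContractibleSpace (Fin n → I) :=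
  have : ContractibleSpace (Metric.closedBall (0 : Fin n → ℝ) 1) :=
    (convex_closedBall _ _).contractibleSpace ⟨0, by simp⟩
  (cubeHomeomorph n).contractibleSpace

/-- Every map from the boundary of the `n`-cube to `F` extends to the cube. -/
def CubeExtension (n : ℕ) (F : Type*) [TopologicalSpace F] : Prop :=
  ∀ u : C(Cube.boundary (Fin n), F), ∃ f : C(Fin n → I, F), ∀ a : Cube.boundary (Fin n), f a = u a

section CubeExtension

variable {F G : Type*} [TopologicalSpace F] [TopologicalSpace G]

theorem CubeExtension.of_retract {n : ℕ} (h : CubeExtension n G) (i : C(F, G)) (r : C(G, F))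
    (hri : ∀ x, r (i x) = x) : CubeExtension n F := fun u => by
  obtain ⟨f, hf⟩ := h (i.comp u)
  exact ⟨r.comp f, fun a => by simp [hf, hri]⟩

/-- Splitting off one coordinate turns the extension problem into lifting along the end point
fibration `C(I, F) → F × F` against the boundary of the `n`-cube. Its fibre over `(e₀, e₀)` is the
loop space, and every pair of end points is joined to `(e₀, e₀)`. -/
theorem CubeExtension.of_path {n : ℕ} (e₀ : F) (he₀ : ∀ e, Joined e e₀)
    (h : CubeExtension n (Path e₀ e₀)) : CubeExtension (n + 1) F := by
  let p : C(F, Unit) := ContinuousMap.const F ()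
  have hp : HasPathLifting p :=
    ⟨⟨fun q => ContinuousMap.const I q.1.1, by fun_prop⟩, fun q => ⟨rfl, fun _ => rfl⟩⟩
  have key : Function.Surjective (relPow p (Cube.boundary (Fin (n + 1)))) := by
    refine relPow_cube_succ_surjective n (relPow_surjective_of_fibre
      (hp.relPow isClosed_endpoints hasCollar_unitInterval) (isClosed_cubeBoundary n)
      (hasCollar_cube n) fun b => ⟨relPow p _ (ContinuousMap.const I e₀), ?_, ?_⟩)
    · obtain ⟨γ₀⟩ := he₀ (b.1.1 ⟨0, by simp⟩)
      obtain ⟨γ₁⟩ := he₀ (b.1.1 ⟨1, by simp⟩)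
      obtain ⟨H, hH, hH'⟩ := exists_continuousMap_glue_two
        {z : I × ({0, 1} : Set I) | (z.2 : I) = 0} {z : I × ({0, 1} : Set I) | (z.2 : I) = 1}
        (isClosed_eq (by fun_prop) (by fun_prop)) (isClosed_eq (by fun_prop) (by fun_prop))
        (fun z => z.2.2) (fun z => γ₀ z.1.1) (fun z => γ₁ z.1.1) (by fun_prop) (by fun_prop)
        (fun z hz hz' => absurd (hz.symm.trans hz') zero_ne_one)
      have hH : ∀ s, H (s, ⟨0, by simp⟩) = γ₀ s := fun s => hH ⟨(s, ⟨0, by simp⟩), rfl⟩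
      have hH' : ∀ s, H (s, ⟨1, by simp⟩) = γ₁ s := fun s => hH' ⟨(s, ⟨1, by simp⟩), rfl⟩
      refine ⟨⟨⟨fun s => ⟨(H.curry s, ContinuousMap.const I ()), fun _ => rfl⟩, by fun_prop⟩,
        Subtype.ext (Prod.ext (ContinuousMap.ext ?_) rfl),
        Subtype.ext (Prod.ext (ContinuousMap.ext ?_) rfl)⟩⟩
      · rintro ⟨a, rfl | rfl⟩
        · exact (hH 0).trans γ₀.source
        · exact (hH' 0).trans γ₁.source
      · rintro ⟨a, rfl | rfl⟩
        · exact (hH 1).trans γ₀.target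
        · exact (hH' 1).trans γ₁.target
    · have hfib : ∀ (f : Fibre (relPow p ({0, 1} : Set I))
          (relPow p ({0, 1} : Set I) (ContinuousMap.const I e₀))) (a : ({0, 1} : Set I)),
          f.1 a = e₀ := fun f a =>
        DFunLike.congr_fun (congrArg (fun q => q.1.1) f.2) a
      refine h.of_retract
        ⟨fun f => ⟨f.1, hfib f ⟨0, by simp⟩, hfib f ⟨1, by simp⟩⟩,
          continuous_induced_rng.2 continuous_subtype_val⟩
        ⟨fun γ => ⟨γ.toContinuousMap, Subtype.ext (Prod.ext (ContinuousMap.ext ?_) rfl)⟩,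
          continuous_induced_dom.subtype_mk _⟩ (fun _ => rfl)
      rintro ⟨a, rfl | rfl⟩
      · exact γ.source
      · exact γ.target
  intro u
  obtain ⟨f, hf, -⟩ := relPow_surjective_iff.1 key u (ContinuousMap.const _ ()) fun _ => rfl
  exact ⟨f, hf⟩

theorem cons_mem_boundary {k : ℕ} {s : I} {t : Fin k → I}
    (h : (s = 0 ∨ s = 1) ∨ t ∈ Cube.boundary (Fin k)) :
    (Fin.cons s t : Fin (k + 1) → I) ∈ Cube.boundary (Fin (k + 1)) := by
  rcases h with h | ⟨i, hi⟩
  · exact ⟨0, by simpa using h⟩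
  · exact ⟨i.succ, by simpa using hi⟩

/-- A `(k + 1)`-dimensional loop as a loop of `k`-dimensional loops. -/
def genLoopToPath (k : ℕ) (e : F) :
    C(GenLoop (Fin (k + 1)) F e, Path (GenLoop.const : GenLoop (Fin k) F e) GenLoop.const) where
  toFun γ :=
    { toFun s := ⟨⟨fun t => γ (Fin.cons s t), by fun_prop⟩,
        fun t ht => γ.2 _ (cons_mem_boundary (Or.inr ht))⟩
      continuous_toFun := Continuous.subtype_mk
        (ContinuousMap.continuous_of_continuous_uncurry _ (by
          simp only [Function.uncurry_def, ContinuousMap.coe_mk]; fun_prop)) _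
      source' := GenLoop.ext _ _ fun t => γ.2 _ (cons_mem_boundary (Or.inl (Or.inl rfl)))
      target' := GenLoop.ext _ _ fun t => γ.2 _ (cons_mem_boundary (Or.inl (Or.inr rfl))) }
  continuous_toFun := by
    refine continuous_induced_rng.2 (ContinuousMap.continuous_of_continuous_uncurry _
      (Continuous.subtype_mk (ContinuousMap.continuous_of_continuous_uncurry _ ?_) _))
    show Continuous fun x : (GenLoop (Fin (k + 1)) F e × I) × (Fin k → I) =>
      x.1.1 (Fin.cons x.1.2 x.2)
    fun_prop

/-- A loop of `k`-dimensional loops as a `(k + 1)`-dimensional loop. -/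
def pathToGenLoop (k : ℕ) (e : F) :
    C(Path (GenLoop.const : GenLoop (Fin k) F e) GenLoop.const, GenLoop (Fin (k + 1)) F e) where
  toFun l := ⟨⟨fun t => l (t 0) (Fin.tail t), by unfold Fin.tail; fun_prop⟩, by
    rintro t ⟨i, hi⟩
    cases i using Fin.cases with
    | zero =>
      rcases hi with hi | hi
      · simp [hi]
      · simp [hi]
    | succ i => exact (l (t 0)).2 _ ⟨i, hi⟩⟩
  continuous_toFun := by
    refine Continuous.subtype_mk (ContinuousMap.continuous_of_continuous_uncurry _ ?_) _
    show Continuous fun x : Path (GenLoop.const : GenLoop (Fin k) F e) GenLoop.const ×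
      (Fin (k + 1) → I) => x.1 (x.2 0) (Fin.tail x.2)
    unfold Fin.tail
    fun_prop

theorem genLoopToPath_pathToGenLoop (k : ℕ) (e : F)
    (l : Path (GenLoop.const : GenLoop (Fin k) F e) GenLoop.const) :
    genLoopToPath k e (pathToGenLoop k e l) = l :=
  Path.ext (funext fun _ => GenLoop.ext _ _ fun _ => rfl)

/-- The induction on `n` runs for all `k` at once, since lowering the dimension of the cube passes
from `k`-fold to `(k + 1)`-fold loops. -/
theorem cubeExtension_genLoop (e : F)
    (h : ∀ (k : ℕ) (γ : GenLoop (Fin k) F e), Joined γ GenLoop.const) (n k : ℕ) :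
    CubeExtension n (GenLoop (Fin k) F e) := by
  induction n generalizing k with
  | zero =>
    exact fun u => ⟨ContinuousMap.const _ GenLoop.const, fun a => a.2.elim fun i => i.elim0⟩
  | succ n ih =>
    exact CubeExtension.of_path GenLoop.const (h k) ((ih (k + 1)).of_retract (pathToGenLoop k e)
      (genLoopToPath k e) (genLoopToPath_pathToGenLoop k e))

theorem cubeExtension_of_joined_genLoop (e : F)
    (h : ∀ (k : ℕ) (γ : GenLoop (Fin k) F e), Joined γ GenLoop.const) (n : ℕ) :
    CubeExtension n F :=
  (cubeExtension_genLoop e h n 0).of_retract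
    ⟨fun x => ⟨ContinuousMap.const _ x, fun _ ht => ht.elim fun i => i.elim0⟩, by fun_prop⟩
    ⟨fun γ => γ default, by fun_prop⟩ fun _ => rfl

theorem genLoop_joined_iff {N : Type*} {e : F} (γ δ : GenLoop N F e) :
    Joined γ δ ↔ GenLoop.Homotopic γ δ := by
  constructor
  · rintro ⟨P⟩
    exact ⟨⟨⟨⟨fun z => P z.1 z.2, by fun_prop⟩, fun t => by simp, fun t => by simp⟩,
      fun s t ht => ((P s).2 t ht).trans (γ.2 t ht).symm⟩⟩
  · rintro ⟨H⟩
    exact ⟨⟨⟨fun s => ⟨H.toContinuousMap.curry s, fun t ht => (H.eq_fst s ht).trans (γ.2 t ht)⟩,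
      by fun_prop⟩, GenLoop.ext _ _ fun t => H.apply_zero t,
      GenLoop.ext _ _ fun t => H.apply_one t⟩⟩

theorem path_homotopic_of_joined {e e' : F} {γ δ : Path e e'} (h : Joined γ δ) :
    γ.Homotopic δ := by
  obtain ⟨P⟩ := h
  refine ⟨⟨⟨⟨fun z => P z.1 z.2, by fun_prop⟩, fun t => by simp, fun t => by simp⟩, ?_⟩⟩
  rintro s t (rfl | rfl)
  · simp
  · simp

end CubeExtension

/-! ### Path fibrations of weak equivalences -/

section WeakEquiv

variable {Y Z : Type*} [TopologicalSpace Y] [TopologicalSpace Z]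

/-- The continuous map between spaces of `k`-dimensional loops induced by a map. -/
def genLoopContinuousMap (k : ℕ) (f : C(Y, Z)) (y : Y) :
    C(GenLoop (Fin k) Y y, GenLoop (Fin k) Z (f y)) :=
  ⟨genLoopMap (Fin k) f y,
    (f.continuous_postcomp.comp continuous_subtype_val).subtype_mk _⟩

/-- The homotopy fibre of the map on `k`-dimensional loops maps to the `k`-dimensional loops in the
homotopy fibre. -/
def homotopyFibreGenLoop (k : ℕ) (f : C(Y, Z)) (y : Y) :
    C(Fibre (pathFibrationEnd (genLoopContinuousMap k f y))
      (genLoopContinuousMap k f y GenLoop.const),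
      GenLoop (Fin k) (Fibre (pathFibrationEnd f) (f y)) (homotopyFibreBase f y)) := by
  let c : C(Fibre (pathFibrationEnd (genLoopContinuousMap k f y))
      (genLoopContinuousMap k f y GenLoop.const) × (Fin k → I), C(I, Z)) :=
    ContinuousMap.curry ⟨fun x => x.1.1.1.1.2 x.2 x.1.2, by fun_prop⟩
  have hc0 : ∀ x, c x 0 = f (x.1.1.1.1 x.2) := fun x =>
    DFunLike.congr_fun x.1.1.2 x.2
  have hc1 : ∀ x, c x 1 = f y := fun x => DFunLike.congr_fun x.1.2 x.2
  let d : C(Fibre (pathFibrationEnd (genLoopContinuousMap k f y))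
      (genLoopContinuousMap k f y GenLoop.const) × (Fin k → I),
      Fibre (pathFibrationEnd f) (f y)) :=
    ⟨fun x => ⟨⟨(x.1.1.1.1 x.2, c x), hc0 x⟩, hc1 x⟩, by fun_prop⟩
  exact ⟨fun e => ⟨d.curry e, fun t ht => Subtype.ext (Subtype.ext (Prod.ext (e.1.1.1.2 t ht)
    (ContinuousMap.ext fun s => (e.1.1.2 s).2 t ht)))⟩, by fun_prop⟩

/-- Exchanging the path and cube variables turns a loop in the homotopy fibre into a point of the
homotopy fibre of the map on loops. Path connectedness of the latter thus kills the homotopy groups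
of the former. -/
theorem homotopyFibreGenLoop_surjective (k : ℕ) (f : C(Y, Z)) (y : Y) :
    Function.Surjective (homotopyFibreGenLoop k f y) := by
  intro w
  have hw : ∀ t ∈ Cube.boundary (Fin k), w t = homotopyFibreBase f y := w.2
  let g : GenLoop (Fin k) Y y := ⟨⟨fun t => (w t).1.1.1, by fun_prop⟩, fun t ht => by
    show (w t).1.1.1 = y
    rw [hw t ht]; rfl⟩
  let H : C(I, C(Fin k → I, Z)) := ContinuousMap.curry ⟨fun x => (w x.2).1.1.2 x.1, by fun_prop⟩
  have hH : ∀ s, H s ∈ GenLoop (Fin k) Z (f y) := fun s t ht => by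
    show (w t).1.1.2 s = f y
    rw [hw t ht]; rfl
  exact ⟨⟨⟨(g, ⟨fun s => ⟨H s, hH s⟩, by fun_prop⟩), GenLoop.ext _ _ fun t => (w t).1.2⟩,
    GenLoop.ext _ _ fun t => (w t).2⟩, rfl⟩

theorem IsWeakHomotopyEquiv.joined_of_joined {f : C(Y, Z)} (hf : IsWeakHomotopyEquiv f) (k : ℕ)
    (y : Y) (γ : GenLoop (Fin k) Y y)
    (h : Joined (genLoopContinuousMap k f y γ) (genLoopContinuousMap k f y GenLoop.const)) :
    Joined γ GenLoop.const := by
  rcases Nat.eq_zero_or_pos k with rfl | hk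
  · have h1 : Joined (f (γ default)) (f y) := by
      obtain ⟨P⟩ := h
      exact ⟨⟨⟨fun s => P s default, by fun_prop⟩, by simp; rfl, by simp; rfl⟩⟩
    have h2 : Joined (γ default) y := Quotient.exact (hf.bijective_zeroth.1
      (a₁ := Quotient.mk _ (γ default)) (a₂ := Quotient.mk _ y) (Quotient.sound h1))
    obtain ⟨P⟩ := h2
    refine ⟨⟨⟨fun s => ⟨ContinuousMap.const _ (P s), fun _ ht => ht.elim fun i => i.elim0⟩,
      by fun_prop⟩, GenLoop.ext _ _ fun t => ?_, GenLoop.ext _ _ fun t => ?_⟩⟩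
    · rw [Subsingleton.elim t default]
      exact P.source
    · exact P.target
  · rw [genLoop_joined_iff] at h ⊢
    exact Quotient.exact ((hf.bijective_pi k hk y).1
      (a₁ := Quotient.mk _ γ) (a₂ := Quotient.mk _ GenLoop.const) (Quotient.sound h))

/-- Surjectivity on `π_(k+1)` is surjectivity on `π₁` of the map between `k`-fold loop spaces. -/
theorem IsWeakHomotopyEquiv.exists_path {f : C(Y, Z)} (hf : IsWeakHomotopyEquiv f) (k : ℕ)
    (y : Y) (l : Path (genLoopContinuousMap k f y GenLoop.const)
      (genLoopContinuousMap k f y GenLoop.const)) :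
    ∃ d : Path (GenLoop.const : GenLoop (Fin k) Y y) GenLoop.const,
      (d.map (genLoopContinuousMap k f y).continuous).Homotopic l := by
  obtain ⟨G, hG⟩ := (hf.bijective_pi (k + 1) (by omega) y).2
    (Quotient.mk _ (pathToGenLoop k (f y) l))
  induction G using Quotient.inductionOn with
  | h G =>
    have h1 : Joined (genLoopMap (Fin (k + 1)) f y G) (pathToGenLoop k (f y) l) :=
      (genLoop_joined_iff _ _).2 (Quotient.exact hG)
    have h2 := h1.map (genLoopToPath k (f y)).continuous
    exact ⟨genLoopToPath k y G, path_homotopic_of_joined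
      ((genLoopToPath_pathToGenLoop k (f y) l) ▸ h2)⟩

/-- By surjectivity on path components only fibres over points `f y` matter. Every iterated loop
space of such a fibre is path connected, by `joined_homotopyFibreBase` applied to the map on loops,
so maps from boundaries of cubes extend. -/
theorem IsWeakHomotopyEquiv.isTrivialFibration {f : C(Y, Z)} (hf : IsWeakHomotopyEquiv f) :
    IsTrivialFibration (pathFibrationEnd f) where
  hasPathLifting := hasPathLifting_pathFibrationEnd f
  surjective_relPow n := by
    refine relPow_surjective_of_fibre (hasPathLifting_pathFibrationEnd f)
      (isClosed_cubeBoundary n) (hasCollar_cube n) fun b => ?_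
    obtain ⟨y, hy⟩ := hf.bijective_zeroth.2 (Quotient.mk _ b)
    induction y using Quotient.inductionOn with
    | h y =>
      refine ⟨f y, (Quotient.exact hy : Joined (f y) b).symm,
        cubeExtension_of_joined_genLoop (homotopyFibreBase f y) (fun k w => ?_) n⟩
      obtain ⟨e, rfl⟩ := homotopyFibreGenLoop_surjective k f y w
      exact (joined_homotopyFibreBase (genLoopContinuousMap k f y) GenLoop.const
        (hf.joined_of_joined k y) (hf.exists_path k y) e).map
        (homotopyFibreGenLoop k f y).continuous

end WeakEquiv

/-! ### Lifting maps from CW complexes -/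

/-- The Euclidean ball is homeomorphic to a cube, as a pair. -/
theorem exists_cubeHomeomorph_euclidean (n : ℕ) :
    ∃ e : (Fin n → I) ≃ₜ Metric.closedBall (0 : EuclideanSpace ℝ (Fin n)) 1,
      ∀ x, x ∈ Cube.boundary (Fin n) ↔ ‖(e x : EuclideanSpace ℝ (Fin n))‖ = 1 := by
  let L := EuclideanSpace.equiv (Fin n) ℝ
  let L' : EuclideanSpace ℝ (Fin n) ≃ₜ (Fin n → ℝ) := L.toHomeomorph
  let s : Set (EuclideanSpace ℝ (Fin n)) := L' ⁻¹' Metric.closedBall 0 1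
  have hi : interior s = L' ⁻¹' Metric.ball 0 1 := by
    rw [← L'.preimage_interior, interior_closedBall _ one_ne_zero]
  have hf : frontier s = L' ⁻¹' Metric.sphere 0 1 := by
    rw [← L'.preimage_frontier, frontier_closedBall _ one_ne_zero]
  have hcl : closure s = s := (Metric.isClosed_closedBall.preimage L'.continuous).closure_eq
  -- The sup-norm ball is a bounded convex set with interior points in Euclidean space, so a
  -- homeomorphism of the whole space takes it to the round ball and its frontier to the sphere.
  obtain ⟨h, -, h₁, h₂⟩ := exists_homeomorph_image_interior_closure_frontier_eq_unitBall (s := s)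
    ((convex_closedBall (0 : Fin n → ℝ) 1).linear_preimage L.toLinearMap)
    (by rw [hi]; exact ⟨0, by simp [L', L]⟩)
    (by
      have : s = L.symm '' Metric.closedBall 0 1 := (L.symm.image_eq_preimage_symm _).symm
      rw [this]
      exact L.symm.lipschitz.isBounded_image Metric.isBounded_closedBall)
  rw [hcl] at h₁
  rw [hf] at h₂
  let H := L'.symm.trans h
  have hH : ∀ x, x ∈ Metric.closedBall (0 : Fin n → ℝ) 1 ↔
      H x ∈ Metric.closedBall (0 : EuclideanSpace ℝ (Fin n)) 1 := fun x => by
    rw [← h₁]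
    simp [H, s]
  refine ⟨(cubeHomeomorph n).trans (H.subtype hH), fun x => ?_⟩
  rw [mem_boundary_iff_norm, ← mem_sphere_zero_iff_norm, ← mem_sphere_zero_iff_norm, ← h₂]
  simp [H]

section CW

variable {E B : Type (max v u)} [TopologicalSpace E] [TopologicalSpace B]

theorem IsTrivialFibration.hasLiftingProperty_disk {p : C(E, B)} (hp : IsTrivialFibration p)
    (n : ℕ) : HasLiftingProperty
      (TopCat.uliftFunctor.{u, v}.map (TopCat.diskBoundaryInclusion.{v} n)) (TopCat.ofHom p) := by
  obtain ⟨e, he⟩ := exists_cubeHomeomorph_euclidean n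
  have key := relPow_surjective_of_homeomorph
    (A' := {x : Metric.closedBall (0 : EuclideanSpace ℝ (Fin n)) 1 | ‖x.1‖ = 1}) e he
    (hp.surjective_relPow n)
  rw [relPow_surjective_iff] at key
  refine ⟨fun {f g} sq => ?_⟩
  obtain ⟨F, hF, hF'⟩ := key
    ⟨fun a => f.hom (ULift.up (ULift.up ⟨a.1.1, mem_sphere_zero_iff_norm.2 a.2⟩)), by
      refine f.hom.continuous.comp (continuous_uliftUp.comp (continuous_uliftUp.comp ?_))
      fun_prop⟩
    ⟨fun d => g.hom (ULift.up (ULift.up d)), by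
      exact g.hom.continuous.comp (continuous_uliftUp.comp continuous_uliftUp)⟩
    (fun a => ConcreteCategory.congr_hom sq.w
      (ULift.up (ULift.up ⟨a.1.1, mem_sphere_zero_iff_norm.2 a.2⟩)))
  refine ⟨⟨⟨TopCat.ofHom ⟨fun x => F x.down.down, ?_⟩, ?_, ?_⟩⟩⟩
  · exact F.continuous.comp (continuous_uliftDown.comp continuous_uliftDown)
  · ext ⟨⟨x, hx⟩⟩
    exact hF ⟨⟨x, Metric.sphere_subset_closedBall hx⟩, mem_sphere_zero_iff_norm.1 hx⟩
  · ext ⟨⟨x⟩⟩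
    exact hF' x

theorem MorphismProperty.inverseImage_isStableUnderCoproducts
    {C : Type*} [Category C] {D : Type*} [Category D] (W : MorphismProperty D) (F : C ⥤ D)
    (J : Type*) [PreservesColimitsOfShape (Discrete J) F]
    [W.IsStableUnderColimitsOfShape (Discrete J)] :
    (W.inverseImage F).IsStableUnderColimitsOfShape (Discrete J) where
  condition X₁ X₂ c₁ c₂ h₁ h₂ f hf φ hφ :=
    MorphismProperty.IsStableUnderColimitsOfShape.condition (W := W) (X₁ ⋙ F) (X₂ ⋙ F)
      (F.mapCocone c₁) (F.mapCocone c₂) (isColimitOfPreserves F h₁) (isColimitOfPreserves F h₂)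
      (Functor.whiskerRight f F) hf (F.map φ) fun j =>
        (F.map_comp _ _).symm.trans ((congrArg F.map (hφ j)).trans (F.map_comp _ _))

/-- The left lifting property passes from cells to coproducts, pushouts and transfinite
compositions. The cells live in a smaller universe than `p`, so the class is pulled back along
`uliftFunctor`, which preserves the colimits involved. -/
theorem IsTrivialFibration.hasLiftingProperty_relativeCWComplex {p : C(E, B)}
    (hp : IsTrivialFibration p) {K L : TopCat.{v}} {i : K ⟶ L} (c : TopCat.RelativeCWComplex i) :
    HasLiftingProperty (TopCat.uliftFunctor.{u, v}.map i) (TopCat.ofHom p) := by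
  let F := TopCat.uliftFunctor.{u, v}
  let W := (MorphismProperty.ofHoms fun _ : Unit => TopCat.ofHom p).llp
  have hW : ∀ {A A' : TopCat.{max v u}} (j : A ⟶ A'), W j ↔
      HasLiftingProperty j (TopCat.ofHom p) := fun j =>
    MorphismProperty.llp_ofHoms_iff_hasLiftingProperty _ _ _
  have h₁ : (MorphismProperty.coproducts.{v} (W.inverseImage F)) ≤ W.inverseImage F := by
    intro A A' j hj
    rw [MorphismProperty.coproducts_iff] at hj
    obtain ⟨J, hJ⟩ := hj
    have := MorphismProperty.inverseImage_isStableUnderCoproducts W F J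
    exact MorphismProperty.colimitsOfShape_le _ hJ
  have h₂ : (MorphismProperty.coproducts.{v} (W.inverseImage F)).pushouts ≤ W.inverseImage F := by
    rintro A A' j ⟨_, _, _, _, _, hj, sq⟩
    exact W.of_isPushout (sq.map F) (h₁ _ hj)
  have h₃ : (MorphismProperty.coproducts.{v}
      (W.inverseImage F)).pushouts.TransfiniteCompositionOfShape ℕ i :=
    HomotopicalAlgebra.RelativeCellComplex.transfiniteCompositionOfShape' c
      (fun s => (hW _).2 (hp.hasLiftingProperty_disk s.j))
  have h₄ : (W.inverseImage F).TransfiniteCompositionOfShape ℕ i :=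
    { h₃.toTransfiniteCompositionOfShape with map_mem := fun j hj => h₂ _ (h₃.map_mem j hj) }
  have : PreservesWellOrderContinuousOfShape ℕ F := ⟨fun j hj => by
    dsimp only [F]; infer_instance⟩
  exact (hW _).1 ((MorphismProperty.transfiniteCompositionsOfShape_le (W := W) (J := ℕ)) _
    ⟨h₄.map⟩)

theorem IsTrivialFibration.exists_lift_of_cwComplex {p : C(E, B)} (hp : IsTrivialFibration p)
    {K : TopCat.{v}} (c : TopCat.CWComplex K) (g : C(K, B)) :
    ∃ h : C(K, E), ∀ x, p (h x) = g x := by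
  have := hp.hasLiftingProperty_relativeCWComplex c
  have hempty : IsEmpty (⊥_ TopCat.{v}) :=
    ⟨fun x => ((initial.to (TopCat.of PEmpty.{v + 1})) x).elim⟩
  let f : TopCat.uliftFunctor.{u, v}.obj (⊥_ TopCat.{v}) ⟶ TopCat.of E :=
    TopCat.ofHom ⟨fun x => (hempty.false x.down).elim, by
      rw [continuous_iff_continuousAt]
      exact fun x => (hempty.false x.down).elim⟩
  have sq : CommSq f (TopCat.uliftFunctor.{u, v}.map (initial.to K)) (TopCat.ofHom p)
      (TopCat.ofHom ⟨fun x => g x.down, g.continuous.comp continuous_uliftDown⟩) :=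
    ⟨by ext x; exact (hempty.false x.down).elim⟩
  obtain ⟨⟨l⟩⟩ := this.sq_hasLift sq
  exact ⟨⟨fun x => l.l.hom (ULift.up x), l.l.hom.continuous.comp continuous_uliftUp⟩,
    fun x => ConcreteCategory.congr_hom l.fac_right (ULift.up x)⟩

/-- A lift on the CW complex gives a lift on `Y` up to homotopy, which path lifting makes strict.
This needs homotopy lifting for `Y` itself, hence a Hurewicz fibration. -/
theorem IsTrivialFibration.exists_lift {p : C(E, B)} (hp : IsTrivialFibration p)
    {Y : Type v} [TopologicalSpace Y] (hY : HasCWHomotopyType Y) (g : C(Y, B)) :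
    ∃ h : C(Y, E), ∀ y, p (h y) = g y := by
  obtain ⟨K, ⟨c⟩, ⟨e⟩⟩ := hY
  obtain ⟨h, hh⟩ := hp.exists_lift_of_cwComplex c (g.comp e.invFun)
  obtain ⟨G⟩ := e.left_inv
  obtain ⟨H, -, hH⟩ := hp.hasPathLifting.exists_lift (h.comp e.toFun)
    ⟨fun z => g (G (z.2, z.1)), by fun_prop⟩ (fun y => by simp [hh])
  exact ⟨⟨fun y => H (y, 1), by fun_prop⟩, fun y => by simp [hH]⟩

end CW

/-! ### Products with locally compact `X`-generated spaces -/

section GeneratedBy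

variable {ι : Type t} {X : ι → Type w} [∀ i, TopologicalSpace (X i)]

/-- With only empty test spaces every function on `I` would be continuous, contradicting
connectedness. -/
theorem IsConvenient.exists_nonempty [IsConvenient X] : ∃ i, Nonempty (X i) := by
  by_contra! h
  have := IsConvenient.isGeneratedBy_unitInterval (X := X)
  have hc : Continuous fun s : I => decide (s = 0) := by
    rw [IsGeneratedBy.continuous_iff X]
    intro i f
    have := h i
    rw [continuous_iff_continuousAt]
    exact fun x => this.elim x
  have h0 := PreconnectedSpace.constant inferInstance hc (x := 0) (y := 1)
  simp at h0

theorem continuous_curry_of_continuousGeneratedBy {Y Z T : Type*} [TopologicalSpace Y]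
    [TopologicalSpace Z] [TopologicalSpace T] [IsGeneratedBy X Y] (f : Y → C(Z, T))
    (hf : ∀ ⦃i⦄ (g : C(X i, Y)), Continuous fun x : X i × Z => f (g x.1) x.2) : Continuous f := by
  rw [IsGeneratedBy.continuous_iff X]
  exact fun i g => ContinuousMap.continuous_of_continuous_uncurry _ (hf g)

/-- Continuity of the identity into the generated refinement is known on `X i × X j`. Currying
replaces `X j` by `Z`, using that `X i` is locally compact, and then `X i` by `Y`, using that `Z`
is. -/
theorem IsConvenient.isGeneratedBy_prod_of_locallyCompact [IsConvenient X] (Y Z : Type*)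
    [TopologicalSpace Y] [TopologicalSpace Z] [IsGeneratedBy X Y] [IsGeneratedBy X Z]
    [LocallyCompactSpace Z] : IsGeneratedBy X (Y × Z) := by
  have hlc := IsConvenient.locallyCompactSpace (X := X)
  have hprod := IsConvenient.isGeneratedBy_prod (X := X)
  rw [isGeneratedBy_iff]
  let e : Y × Z → WithGeneratedByTopology X (Y × Z) := WithGeneratedByTopology.equiv.symm
  have he := (WithGeneratedByTopology.equivSymmAsContinuousMapGeneratedBy X (Y × Z)).prop
  have h₁ : ∀ ⦃i⦄ (f : C(X i, Y)) ⦃j⦄ (g : C(X j, Z)),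
      Continuous fun x : X i × X j => e (f x.1, g x.2) := fun i f j g =>
    (ContinuousMapGeneratedBy.continuousGeneratedBy_dom_prod_iff e).1 he j g i f |>.comp
      continuous_swap
  have h₂ : ∀ ⦃i⦄ (f : C(X i, Y)), Continuous fun x : X i × Z => e (f x.1, x.2) := by
    intro i f
    have hc : ∀ z, Continuous fun x : X i => e (f x, z) := fun z => by
      have := he ⟨fun x : X i => (f x, z), by fun_prop⟩
      exact this
    have : Continuous fun z : Z => (⟨fun x : X i => e (f x, z), hc z⟩ : C(X i, _)) :=
      continuous_curry_of_continuousGeneratedBy (X := X) _ fun j g =>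
        (h₁ f g).comp continuous_swap
    exact (ContinuousMap.continuous_uncurry_of_continuous ⟨_, this⟩).comp continuous_swap
  have hc : ∀ y, Continuous fun z : Z => e (y, z) := fun y => by
    rw [IsGeneratedBy.continuous_iff X]
    exact fun i f => he ⟨fun x : X i => (y, f x), by fun_prop⟩
  have : Continuous fun y : Y => (⟨fun z : Z => e (y, z), hc y⟩ : C(Z, _)) :=
    continuous_curry_of_continuousGeneratedBy (X := X) _ fun i f => h₂ f
  exact ContinuousMap.continuous_uncurry_of_continuous ⟨_, this⟩

theorem IsConvenient.isGeneratedBy_prod_cube [IsConvenient X] (Y : Type*) [TopologicalSpace Y]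
    [IsGeneratedBy X Y] (n : ℕ) : IsGeneratedBy X (Y × (Fin n → I)) := by
  have := IsConvenient.isGeneratedBy_unitInterval (X := X)
  induction n with
  | zero =>
    exact (Homeomorph.prodUnique Y (Fin 0 → I)).symm.isQuotientMap.isGeneratedBy
  | succ n ih =>
    have := IsConvenient.isGeneratedBy_prod_of_locallyCompact (X := X) (Y × (Fin n → I)) I
    let e : (Y × (Fin n → I)) × I ≃ₜ Y × (Fin (n + 1) → I) :=
      (Homeomorph.prodAssoc _ _ _).trans ((Homeomorph.refl Y).prodCongr
        (((Homeomorph.refl _).prodCongr (Homeomorph.funUnique (Fin 1) I).symm).trans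
          (cubeProdHomeomorph n 1)))
    exact e.isQuotientMap.isGeneratedBy

/-! ### Lifting out of products in the convenient category -/

/-- Maps from `L` in the convenient category lift along trivial fibrations. -/
def LiftsAlongTrivialFibrations (X : ι → Type w) [∀ i, TopologicalSpace (X i)] (L : Type v)
    [TopologicalSpace L] : Prop :=
  ∀ (E B : Type (max v u)) [TopologicalSpace E] [TopologicalSpace B] (p : C(E, B)),
    IsTrivialFibration p → ∀ g : L → B, ContinuousGeneratedBy X g →
      ∃ h : L → E, ContinuousGeneratedBy X h ∧ ∀ l, p (h l) = g l

theorem LiftsAlongTrivialFibrations.of_retract {L L' : Type v} [TopologicalSpace L]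
    [TopologicalSpace L'] (hL : LiftsAlongTrivialFibrations.{t, w, v, u} X L) {i : L' → L}
    {r : L → L'} (hi : Continuous i) (hr : Continuous r) (hri : ∀ x, r (i x) = x) :
    LiftsAlongTrivialFibrations.{t, w, v, u} X L' := by
  intro E B _ _ p hp g hg
  obtain ⟨h, hh, hh'⟩ := hL E B p hp (g ∘ r) (hg.comp hr.continuousGeneratedBy)
  exact ⟨h ∘ i, hh.comp hi.continuousGeneratedBy, fun x => by simp [hh', hri]⟩

theorem continuous_generatedBy_eval [IsConvenient X] {L B : Type*} [TopologicalSpace L]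
    [TopologicalSpace B] (l : L) :
    Continuous fun f : ContinuousMapGeneratedBy X L B => f l := by
  obtain ⟨i, ⟨x⟩⟩ := IsConvenient.exists_nonempty (X := X)
  exact (ContinuousEvalConst.continuous_eval_const x).comp
    (ContinuousMapGeneratedBy.continuous_precomp (T := B) (ContinuousMap.const (X i) l))

/-- Postcomposition with a continuous map, on spaces of `X`-continuous maps. -/
def generatedByPostcomp (X : ι → Type w) [∀ i, TopologicalSpace (X i)] (L : Type*)
    [TopologicalSpace L] {E B : Type*} [TopologicalSpace E] [TopologicalSpace B] (p : C(E, B)) :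
    C(ContinuousMapGeneratedBy X L E, ContinuousMapGeneratedBy X L B) where
  toFun f := ⟨p ∘ f, p.continuous.continuousGeneratedBy.comp f.prop⟩
  continuous_toFun := ContinuousMapGeneratedBy.continuous_iff.2 fun _ g =>
    p.continuous_postcomp.comp (ContinuousMapGeneratedBy.continuous_precomp g)

/-- The path lifting function is applied pointwise in `L`; continuity is tested after restriction
along maps `X i → L`, where local compactness of `X i` allows evaluation. -/
theorem HasPathLifting.generatedByPostcomp [IsConvenient X] (L : Type*) [TopologicalSpace L]
    {E B : Type*} [TopologicalSpace E] [TopologicalSpace B] {p : C(E, B)} (hp : HasPathLifting p) :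
    HasPathLifting (generatedByPostcomp X L p) := by
  have hlc := IsConvenient.locallyCompactSpace (X := X)
  obtain ⟨Λ, hΛ⟩ := hp
  let φ : PathLiftProblem (_root_.generatedByPostcomp X L p) → L → PathLiftProblem p := fun q l =>
    ⟨(q.1.1 l, ⟨fun s => q.1.2 s l, (continuous_generatedBy_eval l).comp q.1.2.continuous⟩),
      congrArg (fun f => f l) q.2⟩
  have hφ : ∀ ⦃i⦄ (f : C(X i, L)), Continuous
      fun x : PathLiftProblem (_root_.generatedByPostcomp X L p) × X i => φ x.1 (f x.2) := by
    intro i f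
    refine Continuous.subtype_mk (Continuous.prodMk ?_
      (ContinuousMap.continuous_of_continuous_uncurry _ ?_)) _
    · have : Continuous fun x : PathLiftProblem (_root_.generatedByPostcomp X L p) × X i =>
        ContinuousMapGeneratedBy.precomp f x.1.1.1 x.2 := by fun_prop
      exact this
    · have : Continuous fun x : (PathLiftProblem (_root_.generatedByPostcomp X L p) × X i) × I =>
        ContinuousMapGeneratedBy.precomp f (x.1.1.1.2 x.2) x.1.2 := by fun_prop
      exact this
  let Φ : C(PathLiftProblem (_root_.generatedByPostcomp X L p) × I,
      ContinuousMapGeneratedBy X L E) :=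
    ⟨fun x => ⟨fun l => Λ (φ x.1 l) x.2, fun i f => by
      have := hφ f
      have h : Continuous fun y => Λ (φ x.1 (f y)) x.2 :=
        ((Λ.continuous.comp this).comp (Continuous.prodMk_right x.1)).eval_const x.2
      exact h⟩, ContinuousMapGeneratedBy.continuous_iff.2 fun i f => by
        refine ContinuousMap.continuous_of_continuous_uncurry _ ?_
        have h : Continuous
            fun x : (PathLiftProblem (_root_.generatedByPostcomp X L p) × I) × X i =>
            Λ (φ x.1.1 (f x.2)) x.1.2 :=
          ((Λ.continuous.comp (hφ f)).comp
            ((continuous_fst.comp continuous_fst).prodMk continuous_snd)).eval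
            (continuous_snd.comp continuous_fst)
        exact h⟩
  refine ⟨Φ.curry, fun q => ⟨?_, fun s => ?_⟩⟩
  · exact ContinuousMapGeneratedBy.ext (funext fun l => (hΛ (φ q l)).1)
  · exact ContinuousMapGeneratedBy.ext (funext fun l => (hΛ (φ q l)).2 s)

/-- Exchanging variables, a lifting problem against the boundary of a cube becomes a map from `L` to
be lifted along the relative power of `p`, again a trivial fibration. -/
theorem IsTrivialFibration.generatedByPostcomp [IsConvenient X] {L : Type v} [TopologicalSpace L]
    (hL : LiftsAlongTrivialFibrations.{t, w, v, u} X L)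
    {E B : Type (max v u)} [TopologicalSpace E] [TopologicalSpace B] {p : C(E, B)}
    (hp : IsTrivialFibration p) : IsTrivialFibration (generatedByPostcomp X L p) where
  hasPathLifting := hp.hasPathLifting.generatedByPostcomp L
  surjective_relPow n := by
    have hlc := IsConvenient.locallyCompactSpace (X := X)
    rw [relPow_surjective_iff]
    intro f g hfg
    let q : L → RelLift p (Cube.boundary (Fin n)) := fun l =>
      ⟨(⟨fun a => f a l, (continuous_generatedBy_eval l).comp f.continuous⟩,
        ⟨fun d => g d l, (continuous_generatedBy_eval l).comp g.continuous⟩),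
        fun a => congrArg (fun k => k l) (hfg a)⟩
    have hq : ContinuousGeneratedBy X q := by
      intro i k
      refine Continuous.subtype_mk (Continuous.prodMk
        (ContinuousMap.continuous_of_continuous_uncurry _ ?_)
        (ContinuousMap.continuous_of_continuous_uncurry _ ?_)) _
      · have : Continuous fun x : X i × Cube.boundary (Fin n) =>
          ContinuousMapGeneratedBy.precomp k (f x.2) x.1 := by fun_prop
        exact this
      · have : Continuous fun x : X i × (Fin n → I) =>
          ContinuousMapGeneratedBy.precomp k (g x.2) x.1 := by fun_prop
        exact this
    obtain ⟨h, hh, hh'⟩ := hL _ _ _ (hp.relPow n) q hq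
    have hcont : ∀ ⦃i⦄ (k : C(X i, L)), Continuous fun x : X i × (Fin n → I) => h (k x.1) x.2 :=
      fun i k => ContinuousMap.continuous_uncurry_of_continuous ⟨_, hh k⟩
    refine ⟨⟨fun d => ⟨fun l => h l d, fun i k => (hcont k).comp (Continuous.prodMk_left d)⟩, ?_⟩,
      fun a => ?_, fun d => ?_⟩
    · exact ContinuousMapGeneratedBy.continuous_iff.2 fun i k =>
        ContinuousMap.continuous_of_continuous_uncurry _ ((hcont k).comp continuous_swap)
    · exact ContinuousMapGeneratedBy.ext (funext fun l =>
        DFunLike.congr_fun (congrArg (fun q => q.1.1) (hh' l)) a)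
    · exact ContinuousMapGeneratedBy.ext (funext fun l =>
        DFunLike.congr_fun (congrArg (fun q => q.1.2) (hh' l)) d)

/-- A map on `L × Y` is a map from `Y` to a space of maps on `L`, so only `Y` itself needs to have
CW homotopy type, not the product. -/
theorem LiftsAlongTrivialFibrations.prod [IsConvenient X] {L Y : Type v} [TopologicalSpace L]
    (hL : LiftsAlongTrivialFibrations.{t, w, v, u} X L) [TopologicalSpace Y] [IsGeneratedBy X Y]
    (hY : HasCWHomotopyType Y) : LiftsAlongTrivialFibrations.{t, w, v, u} X (L × Y) := by
  have hlc := IsConvenient.locallyCompactSpace (X := X)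
  have hprod := IsConvenient.isGeneratedBy_prod (X := X)
  intro E B _ _ p hp g hg
  let g' := ContinuousMapGeneratedBy.curryEquiv ⟨g, hg⟩
  have hg' : Continuous g' := (IsGeneratedBy.continuous_iff X _).2 g'.prop
  obtain ⟨h, hh⟩ := IsTrivialFibration.exists_lift.{v, u} (hp.generatedByPostcomp hL) hY ⟨g', hg'⟩
  let h' := ContinuousMapGeneratedBy.curryEquiv.symm ⟨h, h.continuous.continuousGeneratedBy⟩
  exact ⟨h', h'.prop, fun z => congrArg (fun k => k z.1) (hh z.2)⟩

theorem liftsAlongTrivialFibrations_of_unique {L : Type v} [TopologicalSpace L] [Unique L] :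
    LiftsAlongTrivialFibrations.{t, w, v, u} X L := by
  intro E B _ _ p hp g hg
  -- The `0`-cube has empty boundary, so this is surjectivity of `p`.
  obtain ⟨f, -, hf⟩ := relPow_surjective_iff.1 (hp.surjective_relPow 0)
    ⟨fun a => (a.2.elim fun i => i.elim0 : False).elim,
      continuous_of_const fun a => a.2.elim fun i => i.elim0⟩
    (ContinuousMap.const _ (g default)) fun a => a.2.elim fun i => i.elim0
  refine ⟨fun _ => f default, continuous_const.continuousGeneratedBy, fun l => ?_⟩
  rw [hf, Subsingleton.elim l default]
  rfl

theorem liftsAlongTrivialFibrations_pi [IsConvenient X] {Y : Type v} [TopologicalSpace Y]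
    [IsGeneratedBy X Y] (hY : HasCWHomotopyType Y) (n : ℕ) :
    LiftsAlongTrivialFibrations.{t, w, v, u} X (Fin n → Y) := by
  induction n with
  | zero => exact liftsAlongTrivialFibrations_of_unique
  | succ n ih =>
    exact (ih.prod hY).of_retract (i := fun y => (Fin.tail y, y 0))
      (r := fun z => Fin.cons z.2 z.1) (by unfold Fin.tail; fun_prop) (by fun_prop)
      fun y => Fin.cons_self_tail y

theorem liftsAlongTrivialFibrations_prod_pi [IsConvenient X] {Y Z : Type v} [TopologicalSpace Y]
    [TopologicalSpace Z] [IsGeneratedBy X Y] [IsGeneratedBy X Z] (hY : HasCWHomotopyType Y)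
    (hZ : HasCWHomotopyType Z) (n : ℕ) :
    LiftsAlongTrivialFibrations.{t, w, v, u} X (Y × (Fin n → Z)) :=
  ((liftsAlongTrivialFibrations_pi hZ n).prod hY).of_retract continuous_swap continuous_swap
    fun _ => rfl

end GeneratedBy

/-! ### Faces of cubes in terms of sequences -/

section Seq

/-- Extend a finite tuple to a sequence. -/
def extendSeq {M : Type*} [Zero M] {n : ℕ} (x : Fin n → M) : ℕ → M :=
  fun i => if h : i < n then x ⟨i, h⟩ else 0

@[simp]
theorem extendSeq_val {M : Type*} [Zero M] {n : ℕ} (x : Fin n → M) (i : Fin n) :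
    extendSeq x i = x i := by
  simp [extendSeq]

theorem extendSeq_of_lt {M : Type*} [Zero M] {n : ℕ} (x : ℕ → M) {i : ℕ} (hi : i < n) :
    extendSeq (fun i : Fin n => x i) i = x i :=
  extendSeq_val (fun i : Fin n => x i) ⟨i, hi⟩

/-- Add the entries `j` and `j + 1` of a sequence. -/
def contractSeq {M : Type*} [Add M] (j : ℕ) (x : ℕ → M) : ℕ → M :=
  fun i => if i < j then x i else if i = j then x j + x (j + 1) else x (i + 1)

/-- Remove the entry `j` of a sequence. -/
def removeSeq {M : Type*} (j : ℕ) (x : ℕ → M) : ℕ → M :=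
  fun i => if i < j then x i else x (i + 1)

/-- Remove the first `k` entries of a sequence. -/
def shiftSeq {M : Type*} (k : ℕ) (x : ℕ → M) : ℕ → M :=
  fun i => x (k + i)

theorem shiftSeq_shiftSeq {M : Type*} (k l : ℕ) (x : ℕ → M) :
    shiftSeq l (shiftSeq k x) = shiftSeq (k + l) x := by
  funext i
  simp only [shiftSeq, add_assoc]

theorem contractNth_eq_contractSeq {M : Type*} [Add M] {m : ℕ} (x : ℕ → M) (j : Fin (m + 1)) :
    (j.castSucc.contractNth (· + ·) fun i : Fin (m + 2) => x i) =
      fun i : Fin (m + 1) => contractSeq j x i := by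
  funext i
  simp only [Fin.contractNth, contractSeq, Fin.val_castSucc, Fin.val_succ]
  split_ifs with h₁ h₂
  · rfl
  · rw [h₂]
  · rfl

theorem removeNth_eq_removeSeq {M : Type*} {m : ℕ} (x : ℕ → M) (j : Fin (m + 1)) :
    (j.removeNth fun i : Fin (m + 1) => x i) = fun i : Fin m => removeSeq j x i := by
  funext i
  simp only [Fin.removeNth, removeSeq, Fin.succAbove, Fin.lt_def, Fin.val_castSucc]
  split_ifs <;> simp

variable {M G : Type*} (add : G → G → G)
  (hadd : ∀ a b c, add (add a b) c = add a (add b c)) (e : ℕ → (ℕ → M) → (ℕ → I) → G) {m : ℕ}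
  (h₁ : ∀ p q, p + q < m → ∀ x t, t p = 1 →
    e (p + q + 1) x t = add (e p x t) (e q (shiftSeq (p + 1) x) (shiftSeq (p + 1) t)))

include hadd h₁ in
-- Cutting at `p` and at `p'` leaves three blocks; the two sides are the two bracketings of their
-- sum.
theorem face_one_one_agree (x : ℕ → M) (t : ℕ → I) {p q p' q' : ℕ} (hpq : p + q = m)
    (hpq' : p' + q' = m) (hpp : p < p') (hp : t p = 1) (hp' : t p' = 1) :
    add (e p x t) (e q (shiftSeq (p + 1) x) (shiftSeq (p + 1) t)) =
      add (e p' x t) (e q' (shiftSeq (p' + 1) x) (shiftSeq (p' + 1) t)) := by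
  obtain ⟨r, rfl⟩ : ∃ r, p' = p + r + 1 := ⟨p' - p - 1, by omega⟩
  obtain rfl : q = r + q' + 1 := by omega
  rw [h₁ p r (by omega) x t hp, h₁ r q' (by omega) _ _ (by
    rw [← hp']; simp only [shiftSeq]; congr 1; omega), hadd]
  rw [shiftSeq_shiftSeq, shiftSeq_shiftSeq, show p + 1 + (r + 1) = p + r + 1 + 1 by omega]

variable [AddSemigroup M]
  (he : ∀ m x x' t t', (∀ i ≤ m, x i = x' i) → (∀ i < m, t i = t' i) → e m x t = e m x' t')
  (h₀ : ∀ k < m, ∀ x t, ∀ j ≤ k, t j = 0 → e (k + 1) x t = e k (contractSeq j x) (removeSeq j t))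

include he h₀ in
theorem face_zero_zero_agree (x : ℕ → M) (t : ℕ → I) {j k : ℕ} (hjk : j < k) (hk : k ≤ m)
    (hj0 : t j = 0) (hk0 : t k = 0) :
    e m (contractSeq j x) (removeSeq j t) = e m (contractSeq k x) (removeSeq k t) := by
  obtain ⟨m, rfl⟩ : ∃ n, m = n + 1 := ⟨m - 1, by omega⟩
  obtain ⟨k, rfl⟩ : ∃ n, k = n + 1 := ⟨k - 1, by omega⟩
  rw [h₀ m (by omega) _ _ k (by omega) (by simp [removeSeq, hk0, show ¬ k < j by omega]),
    h₀ m (by omega) _ _ j (by omega) (by simp [removeSeq, hj0, hjk])]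
  refine he _ _ _ _ _ (fun i _ => ?_) (fun i _ => ?_)
  · simp only [contractSeq]
    -- After the shift of `k`, equality means adjacent plus signs: three entries are added, and
    -- associativity is needed.
    by_cases hjk' : j = k
    · subst hjk'
      split_ifs <;> first | rfl | omega | simp_all [add_assoc]
    · split_ifs <;> first | rfl | omega
  · simp only [removeSeq]
    split_ifs <;> first | rfl | omega

include he h₀ h₁ in
-- The contracted entries lie entirely in the block before or after the cut at `p`, so contracting
-- and cutting commute.
theorem face_zero_one_agree (x : ℕ → M) (t : ℕ → I) {j p q : ℕ} (hj : j ≤ m) (hpq : p + q = m)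
    (hj0 : t j = 0) (hp : t p = 1) :
    e m (contractSeq j x) (removeSeq j t) =
      add (e p x t) (e q (shiftSeq (p + 1) x) (shiftSeq (p + 1) t)) := by
  rcases lt_trichotomy j p with hjp | rfl | hjp
  · obtain ⟨p, rfl⟩ : ∃ n, p = n + 1 := ⟨p - 1, by omega⟩
    obtain rfl : m = p + q + 1 := by omega
    rw [h₁ p q (by omega) _ _ (by simp [removeSeq, hp, show ¬ p < j by omega]),
      h₀ p (by omega) _ _ j (by omega) hj0]
    congr 1
    refine he _ _ _ _ _ (fun i _ => ?_) (fun i _ => ?_)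
    · simp only [shiftSeq, contractSeq]
      split_ifs <;> first | omega | (congr 1; omega)
    · simp only [shiftSeq, removeSeq]
      split_ifs <;> first | omega | (congr 1; omega)
  · exact absurd (hj0.symm.trans hp) zero_ne_one
  · obtain ⟨r, rfl⟩ : ∃ r, j = p + r + 1 := ⟨j - p - 1, by omega⟩
    obtain ⟨q, rfl⟩ : ∃ n, q = n + 1 := ⟨q - 1, by omega⟩
    obtain rfl : m = p + q + 1 := by omega
    rw [h₁ p q (by omega) _ _ (by simp [removeSeq, hp, show p < p + r + 1 by omega]),
      h₀ q (by omega) _ _ r (by omega) (by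
        rw [← hj0]; simp only [shiftSeq]; congr 1; omega)]
    congr 1
    · refine he _ _ _ _ _ (fun i _ => ?_) (fun i _ => ?_)
      · simp [contractSeq, show i < p + r + 1 by omega]
      · simp [removeSeq, show i < p + r + 1 by omega]
    · refine he _ _ _ _ _ (fun i _ => ?_) (fun i _ => ?_)
      · simp only [shiftSeq, contractSeq]
        split_ifs <;> first | omega | (congr 1 <;> congr 1 <;> omega)
      · simp only [shiftSeq, removeSeq]
        split_ifs <;> first | omega | congr 1

end Seq

/-- Recursion in which a new level may depend on all earlier ones. Later updates do not touch lower
levels, so the diagonal family has every property. -/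
theorem exists_forall_of_succ {L : ℕ → Type*} (P : ∀ _ : ℕ, (∀ k, L k) → Prop)
    (hP : ∀ m Φ Φ', (∀ k ≤ m, Φ k = Φ' k) → P m Φ → P m Φ') (Φ₀ : ∀ k, L k) (h₀ : P 0 Φ₀)
    (hs : ∀ m Φ, (∀ k ≤ m, P k Φ) → ∃ ψ, P (m + 1) (Function.update Φ (m + 1) ψ)) :
    ∃ Φ, ∀ m, P m Φ := by
  choose ψ hψ using hs
  let Ψ : ∀ n, {Φ : ∀ k, L k // ∀ k ≤ n, P k Φ} := fun n => Nat.rec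
    ⟨Φ₀, fun k hk => (Nat.le_zero.1 hk) ▸ h₀⟩
    (fun n Φ => ⟨Function.update Φ.1 (n + 1) (ψ n Φ.1 Φ.2), fun k hk => by
      rcases Nat.le_succ_iff.1 hk with hk | rfl
      · refine hP k Φ.1 _ (fun l hl => ?_) (Φ.2 k hk)
        rw [Function.update_of_ne (by omega)]
      · exact hψ n Φ.1 Φ.2⟩) n
  have hΨ : ∀ n k, k ≤ n → (Ψ n).1 k = (Ψ k).1 k := by
    intro n k hk
    induction n, hk using Nat.le_induction with
    | base => rfl
    | succ n hk ih =>
      rw [← ih]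
      exact Function.update_of_ne (by omega) _ _
  exact ⟨fun k => (Ψ k).1 k, fun m => hP m (Ψ m).1 _ (fun k hk => hΨ m k hk)
    ((Ψ m).2 m le_rfl)⟩

theorem continuous_of_finite_closed_cover {Y Z κ : Type*} [TopologicalSpace Y]
    [TopologicalSpace Z] [Finite κ] (P : κ → Set Y) (hP : ∀ k, IsClosed (P k))
    (hcov : ∀ y, ∃ k, y ∈ P k) {f : Y → Z} {g : κ → Y → Z} (hg : ∀ k, Continuous (g k))
    (hfg : ∀ k, ∀ y ∈ P k, f y = g k y) : Continuous f :=
  (locallyFinite_of_finite P).continuous (Set.eq_univ_of_forall fun y => Set.mem_iUnion.2 (hcov y))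
    hP fun k => (hg k).continuousOn.congr (hfg k)

/-! ### Lifting distributors -/

section Distributor

variable {ι : Type t} {X : ι → Type w} [∀ i, TopologicalSpace (X i)]
  {C : Type u} [Category.{v} C] [HasZeroMorphisms C] [∀ A B : C, TopologicalSpace (A ⟶ B)]
  [HomAddition C] {N : ℕ∞}

theorem Distributor.face_zero_seq (φ : Distributor X C N) {m j : ℕ}
    (hm : ((m + 1 : ℕ) : ℕ∞) ≤ N) (hj : j ≤ m) {Z A B : C} (a : A ⟶ B) (x : ℕ → (Z ⟶ A))
    (s : ℕ → I) (hs : s j = 0) :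
    φ.cube (m + 1) a (fun i => x i) (fun i => s i) =
      φ.cube m a (fun i => contractSeq j x i) (fun i => removeSeq j s i) := by
  have := φ.cube_face_zero m hm a (fun i => x i) (fun i => s i) ⟨j, by omega⟩ hs
  rwa [contractNth_eq_contractSeq, removeNth_eq_removeSeq] at this

theorem Distributor.face_one_seq (φ : Distributor X C N) {p q : ℕ}
    (hm : ((p + q + 1 : ℕ) : ℕ∞) ≤ N) {Z A B : C} (a : A ⟶ B) (x : ℕ → (Z ⟶ A))
    (s : ℕ → I) (hs : s p = 1) :
    φ.cube (p + q + 1) a (fun i => x i) (fun i => s i) =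
      φ.cube p a (fun i => x i) (fun i => s i) +
        φ.cube q a (fun i => shiftSeq (p + 1) x i) (fun i => shiftSeq (p + 1) s i) :=
  φ.cube_face_one p q hm a (fun i => x i) (fun i => s i) hs

theorem continuous_contractSeq [IsLeftLinear X C] {i : ι} {A B : C} {x : X i → ℕ → (A ⟶ B)}
    (hx : ∀ k, Continuous fun y => x y k) (j k : ℕ) :
    Continuous fun y => contractSeq j (x y) k := by
  simp only [contractSeq]
  split_ifs
  · exact hx _
  · exact IsLeftLinear.continuous_add (X := X) A B
      ⟨fun y => (x y j, x y (j + 1)), (hx _).prodMk (hx _)⟩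
  · exact hx _

theorem continuous_extendSeq {M Y : Type*} [TopologicalSpace Y] [TopologicalSpace M] [Zero M]
    {n : ℕ} {x : Y → Fin n → M} (hx : Continuous x) (k : ℕ) :
    Continuous fun y => extendSeq (x y) k := by
  simp only [extendSeq]
  split_ifs
  · exact (continuous_apply _).comp hx
  · exact continuous_const

theorem continuous_removeSeq {M Y : Type*} [TopologicalSpace Y] [TopologicalSpace M]
    {x : Y → ℕ → M} (hx : ∀ k, Continuous fun y => x y k) (j k : ℕ) :
    Continuous fun y => removeSeq j (x y) k := by
  simp only [removeSeq]
  split_ifs <;> exact hx _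

end Distributor

/-! ### Lifting the cubes of a distributor to the path fibrations -/

section Lift

variable {ι : Type t} {X : ι → Type w} [∀ i, TopologicalSpace (X i)]
  {S : Type u₁} [Category.{v₁} S] [HasZeroMorphisms S] [∀ A B : S, TopologicalSpace (A ⟶ B)]
  [HomAddition S]
  {T : Type u₂} [Category.{v₂} T] [HasZeroMorphisms T] [∀ A B : T, TopologicalSpace (A ⟶ B)]
  [HomAddition T] {F : S ⥤ T} (hF : IsLeftLinearMorphism F)

/-- The path fibration of `F : S(A, B) → T(FA, FB)`. -/
abbrev LiftHom (A B : S) :=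
  PathFibration (hF.mapHom A B)

variable (X) in
/-- The pointwise addition of paths in a mapping space. -/
def addPath [IsConvenient X] [IsLeftLinear X T] {A B : T} (γ δ : C(I, A ⟶ B)) : C(I, A ⟶ B) where
  toFun s := γ s + δ s
  continuous_toFun := by
    have := IsConvenient.isGeneratedBy_unitInterval (X := X)
    exact (IsGeneratedBy.continuous_iff X _).2 ((IsLeftLinear.continuous_add A B).comp
      (γ.continuous.prodMk δ.continuous).continuousGeneratedBy)

variable (X) in
/-- The addition on the path fibration. -/
def addLift [IsConvenient X] [IsLeftLinear X T] {A B : S} (e e' : LiftHom hF A B) :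
    LiftHom hF A B :=
  ⟨(e.1.1 + e'.1.1, addPath X e.1.2 e'.1.2), by
    refine (congrArg₂ (· + ·) e.2 e'.2).trans ?_
    exact (hF.map_add _ _).symm⟩

/-- Paths are added pointwise, not concatenated, so associativity is strict, as the agreement of two
faces at `1` requires. -/
theorem addLift_assoc [IsConvenient X] [IsLeftLinear X T] {A B : S} (a b c : LiftHom hF A B) :
    addLift X hF (addLift X hF a b) c = addLift X hF a (addLift X hF b c) :=
  Subtype.ext (Prod.ext (add_assoc _ _ _) (ContinuousMap.ext fun _ => add_assoc _ _ _))

theorem pathFibrationEnd_addLift [IsConvenient X] [IsLeftLinear X T] {A B : S}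
    (a b : LiftHom hF A B) : pathFibrationEnd (hF.mapHom A B) (addLift X hF a b) =
      pathFibrationEnd (hF.mapHom A B) a + pathFibrationEnd (hF.mapHom A B) b :=
  rfl

theorem continuousGeneratedBy_addLift [IsConvenient X] [IsLeftLinear X S] [IsLeftLinear X T]
    (A B : S) : ContinuousGeneratedBy X
      fun p : LiftHom hF A B × LiftHom hF A B => addLift X hF p.1 p.2 := by
  intro i f
  have := IsConvenient.isGeneratedBy_unitInterval (X := X)
  -- Addition in `T` is continuous only on test spaces, so the uncurried map must have an
  -- `X`-generated source.
  have := IsConvenient.isGeneratedBy_prod_of_locallyCompact (X := X) (X i) I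
  refine Continuous.subtype_mk (Continuous.prodMk ?_
    (ContinuousMap.continuous_of_continuous_uncurry _ ?_)) _
  · exact IsLeftLinear.continuous_add (X := X) A B
      ⟨fun x => ((f x).1.1.1, (f x).2.1.1), by fun_prop⟩
  · refine (IsGeneratedBy.continuous_iff X _).2 ((IsLeftLinear.continuous_add _ _).comp
      (f := fun z : X i × I => ((f z.1).1.1.2 z.2, (f z.1).2.1.2 z.2)) ?_)
    exact Continuous.continuousGeneratedBy (by fun_prop)

/-- Families of `m`-cubes in the path fibrations. -/
abbrev CubeLevel (m : ℕ) :=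
  ∀ Z A B : S, (A ⟶ B) → (Fin (m + 1) → (Z ⟶ A)) → C(Fin m → I, LiftHom hF Z B)

variable {N : ℕ∞}

/-- The conditions on the `m`-cubes of a lift of a distributor to the path fibrations. -/
structure IsCubeLift [IsConvenient X] [IsLeftLinear X T] (φ : Distributor X T N) (m : ℕ)
    (Φ : ∀ m, CubeLevel hF m) : Prop where
  proj : ∀ (Z A B : S) (a : A ⟶ B) (x : Fin (m + 1) → (Z ⟶ A)) (s : Fin m → I),
    pathFibrationEnd (hF.mapHom Z B) (Φ m Z A B a x s) =
      φ.cube m (F.map a) (fun i => F.map (x i)) s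
  continuous : ∀ Z A B : S, ContinuousGeneratedBy X
    fun p : (A ⟶ B) × (Fin (m + 1) → (Z ⟶ A)) => Φ m Z A B p.1 p.2
  zero : m = 0 → ∀ (Z A B : S) (a : A ⟶ B) (x : Fin (m + 1) → (Z ⟶ A)) (s : Fin m → I),
    (Φ m Z A B a x s).1.1 = x 0 ≫ a
  face_zero : ∀ k, m = k + 1 → ∀ (Z A B : S) (a : A ⟶ B) (x : ℕ → (Z ⟶ A)) (s : ℕ → I),
    ∀ j ≤ k, s j = 0 → Φ m Z A B a (fun i => x i) (fun i => s i) =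
      Φ k Z A B a (fun i => contractSeq j x i) (fun i => removeSeq j s i)
  face_one : ∀ p q, m = p + q + 1 → ∀ (Z A B : S) (a : A ⟶ B) (x : ℕ → (Z ⟶ A)) (s : ℕ → I),
    s p = 1 → Φ m Z A B a (fun i => x i) (fun i => s i) =
      addLift X hF (Φ p Z A B a (fun i => x i) (fun i => s i))
        (Φ q Z A B a (fun i => shiftSeq (p + 1) x i) (fun i => shiftSeq (p + 1) s i))

theorem IsCubeLift.congr [IsConvenient X] [IsLeftLinear X T] {φ : Distributor X T N} {m : ℕ}
    {Φ Φ' : ∀ m, CubeLevel hF m} (h : ∀ k ≤ m, Φ k = Φ' k) (hΦ : IsCubeLift hF φ m Φ) :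
    IsCubeLift hF φ m Φ' where
  proj := h m le_rfl ▸ hΦ.proj
  continuous := h m le_rfl ▸ hΦ.continuous
  zero := h m le_rfl ▸ hΦ.zero
  face_zero k hk := by
    rw [← h m le_rfl, ← h k (by omega)]
    exact hΦ.face_zero k hk
  face_one p q hk := by
    rw [← h m le_rfl, ← h p (by omega), ← h q (by omega)]
    exact hΦ.face_one p q hk

/-- The two kinds of faces of an `(m + 1)`-cube built from cubes of lower dimension. -/
def liftFace [IsConvenient X] [IsLeftLinear X T] (Φ : ∀ m, CubeLevel hF m) (m : ℕ) {Z A B : S}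
    (k : Fin (m + 1) × Bool) (a : A ⟶ B) (x : ℕ → (Z ⟶ A)) (s : ℕ → I) : LiftHom hF Z B :=
  match k with
  | (j, false) => Φ m Z A B a (fun i => contractSeq j x i) (fun i => removeSeq j s i)
  | (j, true) => addLift X hF (Φ j Z A B a (fun i => x i) (fun i => s i))
      (Φ (m - j) Z A B a (fun i => shiftSeq (j + 1) x i) (fun i => shiftSeq (j + 1) s i))

theorem liftFace_true [IsConvenient X] [IsLeftLinear X T] (Φ : ∀ m, CubeLevel hF m) (p q : ℕ)
    (hp : p < p + q + 1) {Z A B : S} (a : A ⟶ B) (x : ℕ → (Z ⟶ A)) (s : ℕ → I) :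
    liftFace (X := X) hF Φ (p + q) (⟨p, hp⟩, true) a x s =
      addLift X hF (Φ p Z A B a (fun i => x i) (fun i => s i))
        (Φ q Z A B a (fun i => shiftSeq (p + 1) x i) (fun i => shiftSeq (p + 1) s i)) := by
  have h : ∀ r, r = q → Φ r Z A B a (fun i => shiftSeq (p + 1) x i)
      (fun i => shiftSeq (p + 1) s i) = Φ q Z A B a (fun i => shiftSeq (p + 1) x i)
      (fun i => shiftSeq (p + 1) s i) := by
    rintro _ rfl
    rfl
  exact congrArg (addLift X hF _) (h _ (Nat.add_sub_cancel_left ..))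

/-- The part of the boundary of the `(m + 1)`-cube where a face is defined. -/
def faceSet (m : ℕ) (k : Fin (m + 1) × Bool) : Set (Fin (m + 1) → I) :=
  {s | s k.1 = bif k.2 then 1 else 0}

theorem isClosed_faceSet (m : ℕ) (k : Fin (m + 1) × Bool) : IsClosed (faceSet m k) :=
  isClosed_eq (by fun_prop) continuous_const

theorem exists_mem_faceSet {m : ℕ} {s : Fin (m + 1) → I} (hs : s ∈ Cube.boundary (Fin (m + 1))) :
    ∃ k, s ∈ faceSet m k := by
  obtain ⟨j, hj | hj⟩ := hs
  · exact ⟨(j, false), hj⟩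
  · exact ⟨(j, true), hj⟩

theorem faceSet_subset_boundary {m : ℕ} (k : Fin (m + 1) × Bool) :
    faceSet m k ⊆ Cube.boundary (Fin (m + 1)) := by
  rintro s hs
  rcases k with ⟨j, _ | _⟩
  · exact ⟨j, Or.inl hs⟩
  · exact ⟨j, Or.inr hs⟩

theorem continuous_cubeLevel [IsConvenient X] {Φ : ∀ m, CubeLevel hF m} {m : ℕ} {Z A B : S}
    (hΦ : ContinuousGeneratedBy X
      fun p : (A ⟶ B) × (Fin (m + 1) → (Z ⟶ A)) => Φ m Z A B p.1 p.2)
    {i : ι} {Q : Type*} [TopologicalSpace Q] {a : X i → (A ⟶ B)} {x : X i → ℕ → (Z ⟶ A)}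
    {s : Q → ℕ → I} (ha : Continuous a) (hx : ∀ k, Continuous fun y => x y k)
    (hs : ∀ k, Continuous fun y => s y k) :
    Continuous fun z : X i × Q => Φ m Z A B (a z.1) (fun k => x z.1 k) (fun k => s z.2 k) := by
  have h : Continuous fun y : X i => Φ m Z A B (a y) (fun k => x y k) :=
    hΦ ⟨fun y => (a y, fun k => x y k), ha.prodMk (continuous_pi fun k => hx k)⟩
  exact (h.comp continuous_fst).eval (continuous_pi fun k => (hs k).comp continuous_snd)

theorem continuous_liftFace [IsConvenient X] [IsLeftLinear X S] [IsLeftLinear X T]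
    {Φ : ∀ m, CubeLevel hF m} {m : ℕ} {Z A B : S}
    (hΦ : ∀ k ≤ m, ContinuousGeneratedBy X
      fun p : (A ⟶ B) × (Fin (k + 1) → (Z ⟶ A)) => Φ k Z A B p.1 p.2)
    {i : ι} {n : ℕ} {a : X i → (A ⟶ B)} {x : X i → ℕ → (Z ⟶ A)}
    {s : (Fin n → I) → ℕ → I} (ha : Continuous a) (hx : ∀ k, Continuous fun y => x y k)
    (hs : ∀ k, Continuous fun y => s y k) (k : Fin (m + 1) × Bool) :
    Continuous fun z : X i × (Fin n → I) => liftFace (X := X) hF Φ m k (a z.1) (x z.1) (s z.2) := by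
  rcases k with ⟨j, _ | _⟩
  · exact continuous_cubeLevel hF (hΦ m le_rfl) ha (continuous_contractSeq hx j)
      (continuous_removeSeq hs j)
  · have := IsConvenient.isGeneratedBy_prod_cube (X := X) (X i) n
    have h₁ := continuous_cubeLevel hF (hΦ j (by omega)) ha hx hs
    have h₂ := continuous_cubeLevel hF (hΦ (m - j) (by omega)) ha
      (x := fun y => shiftSeq (j + 1) (x y)) (fun k => hx _)
      (s := fun y => shiftSeq (j + 1) (s y)) (fun k => hs _)
    exact (IsGeneratedBy.continuous_iff X _).2 ((continuousGeneratedBy_addLift hF Z B).comp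
      (h₁.prodMk h₂).continuousGeneratedBy)

theorem liftFace_agree [IsConvenient X] [IsLeftLinear X T] {φ : Distributor X T N}
    {Φ : ∀ m, CubeLevel hF m} {m : ℕ} (hΦ : ∀ k ≤ m, IsCubeLift hF φ k Φ) {Z A B : S} (a : A ⟶ B)
    (x : ℕ → (Z ⟶ A)) (s : ℕ → I) (k l : Fin (m + 1) × Bool)
    (hk : s k.1 = bif k.2 then 1 else 0) (hl : s l.1 = bif l.2 then 1 else 0) :
    liftFace (X := X) hF Φ m k a x s = liftFace (X := X) hF Φ m l a x s := by
  let e : ℕ → (ℕ → (Z ⟶ A)) → (ℕ → I) → LiftHom hF Z B := fun m x s =>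
    Φ m Z A B a (fun i => x i) (fun i => s i)
  have he : ∀ m x x' t t', (∀ i ≤ m, x i = x' i) → (∀ i < m, t i = t' i) →
      e m x t = e m x' t' := by
    intro m x x' t t' hx ht
    exact congrArg₂ (fun x t => Φ m Z A B a x t) (funext fun i => hx i (by omega))
      (funext fun i => ht i i.2)
  have h₀ : ∀ k < m, ∀ x t, ∀ j ≤ k, t j = 0 →
      e (k + 1) x t = e k (contractSeq j x) (removeSeq j t) := fun k hk x t j hj ht =>
    (hΦ (k + 1) hk).face_zero k rfl Z A B a x t j hj ht
  have h₁ : ∀ p q, p + q < m → ∀ x t, t p = 1 → e (p + q + 1) x t =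
      addLift X hF (e p x t) (e q (shiftSeq (p + 1) x) (shiftSeq (p + 1) t)) :=
    fun p q hpq x t ht => (hΦ (p + q + 1) hpq).face_one p q rfl Z A B a x t ht
  have hadd := addLift_assoc (X := X) hF (A := Z) (B := B)
  rcases k with ⟨j, _ | _⟩ <;> rcases l with ⟨j', _ | _⟩
  · rcases lt_trichotomy (j : ℕ) j' with h | h | h
    · exact face_zero_zero_agree e he h₀ x s h (by omega) hk hl
    · rw [Fin.ext h]
    · exact (face_zero_zero_agree e he h₀ x s h (by omega) hl hk).symm
  · exact face_zero_one_agree _ e h₁ he h₀ x s (by omega) (by omega) hk hl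
  · exact (face_zero_one_agree _ e h₁ he h₀ (j := j') (p := j) (q := m - j) x s (by omega)
      (by omega) hl hk).symm
  · rcases lt_trichotomy (j : ℕ) j' with h | h | h
    · exact face_one_one_agree _ hadd e h₁ (p := j) (q := m - j) (p' := j') (q' := m - j') x s
        (by omega) (by omega) h hk hl
    · rw [Fin.ext h]
    · exact (face_one_one_agree _ hadd e h₁ (p := j') (q := m - j') (p' := j) (q' := m - j) x s
        (by omega) (by omega) h hl hk).symm

theorem pathFibrationEnd_liftFace [IsConvenient X] [IsLeftLinear X T] {φ : Distributor X T N}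
    {Φ : ∀ m, CubeLevel hF m} {m : ℕ} (hm : ((m + 1 : ℕ) : ℕ∞) ≤ N)
    (hΦ : ∀ k ≤ m, IsCubeLift hF φ k Φ) {Z A B : S} (a : A ⟶ B)
    (x : ℕ → (Z ⟶ A)) (s : ℕ → I) (k : Fin (m + 1) × Bool)
    (hk : s k.1 = bif k.2 then 1 else 0) :
    pathFibrationEnd (hF.mapHom Z B) (liftFace (X := X) hF Φ m k a x s) =
      φ.cube (m + 1) (F.map a) (fun i => F.map (x i)) (fun i => s i) := by
  rcases k with ⟨⟨j, hj⟩, _ | _⟩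
  · refine ((hΦ m le_rfl).proj Z A B a _ _).trans ?_
    refine Eq.trans ?_ (φ.face_zero_seq hm (by omega) (F.map a) (fun i => F.map (x i)) s hk).symm
    refine congrArg (fun y => φ.cube m (F.map a) y _) (funext fun i => ?_)
    simp only [contractSeq]
    split_ifs
    · rfl
    · exact hF.map_add _ _
    · rfl
  · obtain ⟨q, rfl⟩ : ∃ q, m = j + q := ⟨m - j, by omega⟩
    refine Eq.trans ?_ (φ.face_one_seq hm (F.map a) (fun i => F.map (x i)) s hk).symm
    rw [liftFace_true, pathFibrationEnd_addLift, (hΦ j (by omega)).proj, (hΦ q (by omega)).proj]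
    rfl

/-- The inductive step. The faces glue to boundary values `u`, which together with the cubes of `φ`
form a map `q` to the relative lifting problems for `p`; a lift of `q` along the relative power is
the new family of cubes. -/
theorem exists_liftFace_extension [IsConvenient X] [IsLeftLinear X S] [IsLeftLinear X T]
    (hweak : ∀ A B : S, IsWeakHomotopyEquiv (hF.mapHom A B))
    (hCW : ∀ A B : S, HasCWHomotopyType (A ⟶ B)) {φ : Distributor X T N}
    {Φ : ∀ m, CubeLevel hF m} {m : ℕ} (hm : ((m + 1 : ℕ) : ℕ∞) ≤ N)
    (hΦ : ∀ k ≤ m, IsCubeLift hF φ k Φ) (Z A B : S) :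
    ∃ Ψ : (A ⟶ B) × (Fin (m + 2) → (Z ⟶ A)) → C(Fin (m + 1) → I, LiftHom hF Z B),
      ContinuousGeneratedBy X Ψ ∧
      (∀ y s, pathFibrationEnd (hF.mapHom Z B) (Ψ y s) =
        φ.cube (m + 1) (F.map y.1) (fun i => F.map (y.2 i)) s) ∧
      ∀ y k, ∀ s ∈ faceSet m k,
        Ψ y s = liftFace (X := X) hF Φ m k y.1 (extendSeq y.2) (extendSeq s) := by
  let face : Fin (m + 1) × Bool → (A ⟶ B) × (Fin (m + 2) → (Z ⟶ A)) →
      (Fin (m + 1) → I) → LiftHom hF Z B :=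
    fun k y s => liftFace (X := X) hF Φ m k y.1 (extendSeq y.2) (extendSeq s)
  have hmem : ∀ k, ∀ s ∈ faceSet m k, extendSeq s k.1 = bif k.2 then 1 else 0 := fun k s hs => by
    rw [extendSeq_val]; exact hs
  have hu : ∀ (y : (A ⟶ B) × (Fin (m + 2) → (Z ⟶ A))) (s : Cube.boundary (Fin (m + 1))),
      ∃ e, ∀ k, s.1 ∈ faceSet m k → e = face k y s := fun y s => by
    obtain ⟨l, hl⟩ := exists_mem_faceSet s.2
    exact ⟨face l y s, fun k hk => liftFace_agree hF hΦ _ _ _ _ _ (hmem l s hl) (hmem k s hk)⟩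
  choose u hu using hu
  have hface : ∀ ⦃i⦄ (f : C(X i, (A ⟶ B) × (Fin (m + 2) → (Z ⟶ A)))) k,
      Continuous fun z : X i × (Fin (m + 1) → I) => face k (f z.1) z.2 := fun i f k =>
    continuous_liftFace hF (a := fun z => (f z).1) (x := fun z => extendSeq (f z).2)
      (s := fun s => extendSeq s) (fun k hk => (hΦ k hk).continuous Z A B) (by fun_prop)
      (continuous_extendSeq (by fun_prop)) (continuous_extendSeq continuous_id) k
  have hucont : ∀ ⦃i⦄ (f : C(X i, (A ⟶ B) × (Fin (m + 2) → (Z ⟶ A)))),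
      Continuous fun z : X i × Cube.boundary (Fin (m + 1)) => u (f z.1) z.2 := fun i f =>
    continuous_of_finite_closed_cover
      (fun k => {z : X i × Cube.boundary (Fin (m + 1)) | z.2.1 ∈ faceSet m k})
      (fun k => (isClosed_faceSet m k).preimage (by fun_prop))
      (fun z => exists_mem_faceSet z.2.2)
      (g := fun k z => face k (f z.1) z.2)
      (fun k => (hface f k).comp (continuous_fst.prodMk
        (continuous_subtype_val.comp continuous_snd)))
      (fun k z hz => hu _ _ k hz)
  -- A fixed `y` is seen by a constant map from a nonempty test space.
  have hucont' : ∀ y, Continuous (u y) := fun y => by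
    obtain ⟨i, ⟨z⟩⟩ := IsConvenient.exists_nonempty (X := X)
    exact (hucont (ContinuousMap.const (X i) y)).comp (Continuous.prodMk_right z)
  let p := pathFibrationEnd (hF.mapHom Z B)
  let q : (A ⟶ B) × (Fin (m + 2) → (Z ⟶ A)) → RelLift p (Cube.boundary (Fin (m + 1))) :=
    fun y => ⟨(⟨u y, hucont' y⟩, φ.cube (m + 1) (F.map y.1) (fun i => F.map (y.2 i))), fun s => by
      obtain ⟨k, hk⟩ := exists_mem_faceSet s.2
      have := pathFibrationEnd_liftFace hF hm hΦ y.1 (extendSeq y.2) (extendSeq s.1) k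
        (hmem k s hk)
      simp only [extendSeq_val] at this
      refine Eq.trans ?_ this
      exact congrArg p (hu y s k hk)⟩
  have hq : ContinuousGeneratedBy X q := by
    intro i f
    refine Continuous.subtype_mk (Continuous.prodMk
      (ContinuousMap.continuous_of_continuous_uncurry _ (hucont f)) ?_) _
    have h₁ : Continuous fun z : X i => F.map (f z).1 :=
      (hF.continuous_map A B).comp (by fun_prop)
    have h₂ : Continuous fun z : X i => fun k => F.map ((f z).2 k) :=
      continuous_pi fun k => (hF.continuous_map Z A).comp (by fun_prop)
    exact φ.continuous_cube (m + 1) hm _ _ _ ⟨_, h₁.prodMk h₂⟩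
  have := IsPointedTopCategory.isGeneratedBy_hom (X := X) A B
  have := IsPointedTopCategory.isGeneratedBy_hom (X := X) Z A
  obtain ⟨Ψ, hΨ, hΨ'⟩ := liftsAlongTrivialFibrations_prod_pi.{t, w, v₁, v₂} (X := X) (hCW A B)
    (hCW Z A) (m + 2) _ _ _ ((hweak Z B).isTrivialFibration.relPow (m + 1)) q hq
  refine ⟨Ψ, hΨ, fun y s => ?_, fun y k s hs => ?_⟩
  · exact DFunLike.congr_fun (congrArg (fun r => r.1.2) (hΨ' y)) s
  · exact (DFunLike.congr_fun (congrArg (fun r => r.1.1) (hΨ' y))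
      ⟨s, faceSet_subset_boundary k hs⟩).trans (hu y _ k hs)

theorem exists_isCubeLift_succ [IsConvenient X] [IsLeftLinear X S] [IsLeftLinear X T]
    (hweak : ∀ A B : S, IsWeakHomotopyEquiv (hF.mapHom A B))
    (hCW : ∀ A B : S, HasCWHomotopyType (A ⟶ B)) {φ : Distributor X T N}
    {Φ : ∀ m, CubeLevel hF m} {m : ℕ} (hm : ((m + 1 : ℕ) : ℕ∞) ≤ N)
    (hΦ : ∀ k ≤ m, IsCubeLift hF φ k Φ) :
    ∃ ψ : CubeLevel hF (m + 1), IsCubeLift hF φ (m + 1) (Function.update Φ (m + 1) ψ) := by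
  choose Ψ hΨ hproj hface using exists_liftFace_extension hF hweak hCW hm hΦ
  have hface' : ∀ {Z A B : S} (a : A ⟶ B) (x : ℕ → (Z ⟶ A)) (s : ℕ → I) (k : Fin (m + 1) × Bool),
      (s k.1 = bif k.2 then 1 else 0) → Ψ Z A B (a, fun i => x i) (fun i => s i) =
        liftFace (X := X) hF Φ m k a (extendSeq fun i : Fin (m + 2) => x i)
          (extendSeq fun i : Fin (m + 1) => s i) := fun a x s k hk =>
    hface _ _ _ _ k _ hk
  refine ⟨fun Z A B a x => Ψ Z A B (a, x), ?_⟩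
  constructor
  · intro Z A B a x s
    rw [Function.update_self]
    exact hproj Z A B (a, x) s
  · intro Z A B
    rw [Function.update_self]
    exact hΨ Z A B
  · intro h
    omega
  · intro k hk Z A B a x s j hj hs
    obtain rfl : m = k := by omega
    rw [Function.update_self, Function.update_of_ne (by omega)]
    refine (hface' a x s (⟨j, by omega⟩, false) hs).trans ?_
    -- The face reads only indices within the original tuples, so the default value `0` of
    -- `extendSeq` never enters.
    refine congrArg₂ (fun x s => Φ m Z A B a x s) (funext fun i => ?_) (funext fun i => ?_)
    · have := i.2
      simp only [contractSeq]
      split_ifs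
      · exact extendSeq_of_lt x (by omega)
      · exact congrArg₂ (· + ·) (extendSeq_of_lt x (by omega)) (extendSeq_of_lt x (by omega))
      · exact extendSeq_of_lt x (by omega)
    · have := i.2
      simp only [removeSeq]
      split_ifs <;> exact extendSeq_of_lt s (by omega)
  · intro p q hk Z A B a x s hs
    obtain rfl : m = p + q := by omega
    rw [Function.update_self, Function.update_of_ne (by omega), Function.update_of_ne (by omega)]
    refine (hface' a x s (⟨p, by omega⟩, true) hs).trans ?_
    rw [liftFace_true]
    refine congrArg₂ (addLift X hF) ?_ ?_
    · refine congrArg₂ (fun x s => Φ p Z A B a x s) (funext fun i => ?_) (funext fun i => ?_)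
      · exact extendSeq_of_lt x (by omega)
      · exact extendSeq_of_lt s (by omega)
    · refine congrArg₂ (fun x s => Φ q Z A B a x s) (funext fun i => ?_) (funext fun i => ?_)
      · exact extendSeq_of_lt x (by omega)
      · exact extendSeq_of_lt s (by omega)

/-- The `0`-cubes, extended by constant cubes in higher dimensions. -/
def zeroCubes (m : ℕ) : CubeLevel hF m := fun Z _ B a x =>
  ContinuousMap.const _ ⟨(x 0 ≫ a, ContinuousMap.const I (hF.mapHom Z B (x 0 ≫ a))), rfl⟩

theorem isCubeLift_zeroCubes [IsConvenient X] [IsLeftLinear X S] [IsLeftLinear X T]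
    (φ : Distributor X T N) : IsCubeLift hF φ 0 (zeroCubes hF) where
  proj Z A B a x s := by
    rw [φ.cube_zero, ← F.map_comp]
    rfl
  continuous Z A B := by
    intro i f
    have h₁ : Continuous fun z : X i => (f z).2 0 ≫ (f z).1 :=
      IsPointedTopCategory.continuous_comp (X := X) Z A B
        ⟨fun z => ((f z).1, (f z).2 0), by fun_prop⟩
    have h₂ : Continuous fun y : Z ⟶ B => (ContinuousMap.const (Fin 0 → I)
        (⟨(y, ContinuousMap.const I (hF.mapHom Z B y)), rfl⟩ : LiftHom hF Z B)) := by
      fun_prop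
    exact h₂.comp h₁
  zero _ _ _ _ _ _ _ := rfl
  face_zero k hk := by omega
  face_one p q hk := by omega

theorem exists_isCubeLift [IsConvenient X] [IsLeftLinear X S] [IsLeftLinear X T]
    (hweak : ∀ A B : S, IsWeakHomotopyEquiv (hF.mapHom A B))
    (hCW : ∀ A B : S, HasCWHomotopyType (A ⟶ B)) (φ : Distributor X T N) :
    ∃ Φ : ∀ m, CubeLevel hF m, ∀ m : ℕ, (m : ℕ∞) ≤ N → IsCubeLift hF φ m Φ := by
  refine exists_forall_of_succ (fun m Φ => (m : ℕ∞) ≤ N → IsCubeLift hF φ m Φ)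
    (fun m Φ Φ' h hΦ hm => (hΦ hm).congr hF h) (zeroCubes hF)
    (fun _ => isCubeLift_zeroCubes hF φ) fun m Φ hΦ => ?_
  by_cases hm : ((m + 1 : ℕ) : ℕ∞) ≤ N
  · obtain ⟨ψ, hψ⟩ := exists_isCubeLift_succ hF hweak hCW hm fun k hk => hΦ k hk
      (le_trans (by exact_mod_cast Nat.le_succ_of_le hk) hm)
    exact ⟨ψ, fun _ => hψ⟩
  -- Above `N` nothing is required, so any family will do.
  · exact ⟨Φ (m + 1), fun h => absurd h hm⟩

/-- A lift of a distributor to the path fibrations projects to a distributor. -/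
def distributorOfLift [IsConvenient X] [IsLeftLinear X T] {φ : Distributor X T N}
    (Φ : ∀ m, CubeLevel hF m) (hΦ : ∀ m : ℕ, (m : ℕ∞) ≤ N → IsCubeLift hF φ m Φ) :
    Distributor X S N where
  -- The first coordinate of `addLift` is the sum in `S`, so the face relations survive forgetting
  -- the paths.
  cube m Z A B a x := ⟨fun s => (Φ m Z A B a x s).1.1, by fun_prop⟩
  cube_zero a x s := (hΦ 0 (by simp)).zero rfl _ _ _ a x s
  cube_face_zero m hm Z A B a x s j hj := by
    have := (hΦ (m + 1) hm).face_zero m rfl Z A B a (extendSeq x) (extendSeq s) j (by omega)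
      (by rw [extendSeq_val, hj])
    rw [← contractNth_eq_contractSeq, ← removeNth_eq_removeSeq] at this
    simp only [extendSeq_val] at this
    exact congrArg (fun e => e.1.1) this
  cube_face_one p q hm Z A B a x s hs := by
    have := (hΦ (p + q + 1) hm).face_one p q rfl Z A B a (extendSeq x) (extendSeq s)
      ((extendSeq_val s ⟨p, by omega⟩).trans hs)
    simp only [extendSeq_val] at this
    refine (congrArg (fun e => e.1.1) this).trans ?_
    refine congrArg₂ (· + ·) ?_ ?_
    · refine congrArg₂ (fun x s => (Φ p Z A B a x s).1.1) (funext fun i => ?_) (funext fun i => ?_)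
      · exact extendSeq_val x ⟨i, by omega⟩
      · exact extendSeq_val s ⟨i, by omega⟩
    · refine congrArg₂ (fun x s => (Φ q Z A B a x s).1.1) (funext fun i => ?_) (funext fun i => ?_)
      · exact extendSeq_val x ⟨p + 1 + i, by omega⟩
      · exact extendSeq_val s ⟨p + 1 + i, by omega⟩
  continuous_cube m hm Z A B :=
    (ContinuousMap.continuous_postcomp (⟨fun e => e.1.1, by fun_prop⟩ :
      C(LiftHom hF Z B, Z ⟶ B))).continuousGeneratedBy.comp ((hΦ m hm).continuous Z A B)

end Lift

theorem mainTheorem7 {ι : Type t} (X : ι → Type w)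
    [∀ i, TopologicalSpace (X i)] [IsConvenient X]
    {S : Type u₁} [Category.{v₁} S] [HasZeroMorphisms S] [∀ A B : S, TopologicalSpace (A ⟶ B)] [HomAddition S]
    [IsLeftLinear X S]
    {T : Type u₂} [Category.{v₂} T] [HasZeroMorphisms T] [∀ A B : T, TopologicalSpace (A ⟶ B)] [HomAddition T]
    [IsLeftLinear X T]
    (F : S ⥤ T) (hF : IsLeftLinearMorphism F)
    (hweak : ∀ A B : S, IsWeakHomotopyEquiv (hF.mapHom A B))
    (hCW : ∀ A B : S, HasCWHomotopyType (A ⟶ B))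
    (N : ℕ∞) (hN : 1 ≤ N) (hT : IsDistributive X T N) :
    IsDistributive X S N := by
  obtain ⟨φ⟩ := hT
  obtain ⟨Φ, hΦ⟩ := exists_isCubeLift hF hweak hCW φ
  exact ⟨distributorOfLift hF Φ hΦ⟩
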